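/- **Conventions.** Let $n\ge 1$ and let $(\mathcal C,\mathbb E,\mathfrak s)$ be an $n$-exangulated category in the sense of Herschend–Liu–Nakaoka: $\mathcal C$ is additive, $\mathbb E:\mathcal C^{\rm op}\times\mathcal C\to\mathrm{Ab}$ is biadditive, and $\mathfrak s$ is an exact realization of $\mathbb E$, so that $\mathfrak s(\delta)$, for $\delta\in\mathbb E(C,A)$, is a homotopy equivalence class, with fixed ends, of complexes $A\to X_1\to\cdots\to X_n\to C$. Write $a_*\delta=\mathbb E(C,a)(\delta)$ and $c^*\delta=\mathbb E(c,A)(\delta)$. If $\mathfrak s(\delta)=[X_\bullet]$, then $\langle X_\bullet,\delta\rangle$ is called a distinguished $n$-exangle. Let $\mathcal F$ be a class of morphisms of $\mathcal C$, and let $\mathcal N_{\mathcal F}$ be the class of objects $N$ such that $N\to 0$ and $0\to N$ are in $\mathcal F$. Let $p:\mathcal C\to\overline{\mathcal C}=\mathcal C/[\mathcal N_{\mathcal F}]$, $f\mapsto\overline f$, be the quotient by the ideal of morphisms that factor through an object of $\mathcal N_{\mathcal F}$, and let $\overline{\mathcal F}$ be the closure of $p(\mathcal F)$ under composition with isomorphisms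 of $\overline{\mathcal C}$. Assume: * (M0) $\mathcal F$ contains all isomorphisms and is closed under composition and finite direct sums, and $\mathcal F=p^{-1}(\overline{\mathcal F})$; * (MR1) $\overline{\mathcal F}$ has the 2-out-of-3 property for compositions; * (MR2) $\overline{\mathcal F}$ is a multiplicative system (it admits left and right calculus of fractions); * (MR3) for distinguished $n$-exangles $\langle X_\bullet,\delta\rangle$, $\langle Y_\bullet,\delta'\rangle$ with differentials $f_i$, $g_i$ and morphisms $a:X_0\to Y_0$, $c:X_{n+1}\to Y_{n+1}$ with $a_*\delta=c^*\delta'$ and $\overline a,\overline c\in\overline{\mathcal F}$, there are $b_i\in\overline{\mathcal F}(X_i,Y_i)$, $1\le i\le n$, such that $(\overline a,b_1,\dots,b_n,\overline c)$ commutes with the differentials $\overline{f_i}$, $\overline{g_i}$ in $\overline{\mathcal C}$. Let $\overline Q:\overline{\mathcal C}\to\widetilde{\mathcal C}$ be the localization of $\overline{\mathcal C}$ by $\overline{\mathcal F}$, and $Q=\overline Q\circ p:\mathcal C\to\widetilde{\mathcal C}$. Put $\mathcal K(C,A)=\{\delta\in\mathbb E(C,A)\mid s_*\delta=0\text{ for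 some }s\in\mathcal F\text{ with source }A\}$. This is an additive subfunctor of $\mathbb E$, and $\mathbb E/\mathcal K$ induces a biadditive functor $\overline{\mathbb E}:\overline{\mathcal C}^{\rm op}\times\overline{\mathcal C}\to\mathrm{Ab}$; write $\overline\delta\in\overline{\mathbb E}(C,A)$ for the class of $\delta$. Let $\widetilde{\mathbb E}(C,A)$ be the set of classes $[\overline t\backslash\overline\delta/\overline s]$ of triples $(\overline t:Z\to C,\ \overline\delta\in\overline{\mathbb E}(Z,X),\ \overline s:A\to X)$ with $\overline s,\overline t\in\overline{\mathcal F}$. Two triples $(\overline{t_i}\backslash\overline{\delta_i}/\overline{s_i})$, $i=1,2$, are equivalent if $\overline{v_1}^*\overline{u_1}_*\overline{\delta_1}=\overline{v_2}^*\overline{u_2}_*\overline{\delta_2}$ for some common denominator, that is, for some $\overline{u_i},\overline{v_i}\in\overline{\mathcal F}$ such that $\overline{u_1}\,\overline{s_1}=\overline{u_2}\,\overline{s_2}$ and $\overline{t_1}\,\overline{v_1}=\overline{t_2}\,\overline{v_2}$. Adding extensions over a common denominator makes $\widetilde{\mathbb E}(C,A)$ an abelian group. It becomes a functor $\widetilde{\mathcal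 C}^{\rm op}\times\widetilde{\mathcal C}\to\mathrm{Ab}$ as follows. * For $\alpha=\overline Q(\overline u)^{-1}\overline Q(\overline a)\in\widetilde{\mathcal C}(A,A')$ with $\overline u\in\overline{\mathcal F}$, put $\alpha_*[\overline t\backslash\overline\delta/\overline s]=[\overline t\backslash\overline{a'}_*\overline\delta/\overline{s'}\,\overline u]$, where $\overline{a'}\,\overline s=\overline{s'}\,\overline a$ and $\overline{s'}\in\overline{\mathcal F}$. * For $\gamma=\overline Q(\overline c)\overline Q(\overline v)^{-1}\in\widetilde{\mathcal C}(C',C)$ with $\overline v\in\overline{\mathcal F}$, put $\gamma^*[\overline t\backslash\overline\delta/\overline s]=[\overline v\,\overline{t'}\backslash\overline{c'}^*\overline\delta/\overline s]$, where $\overline t\,\overline{c'}=\overline c\,\overline{t'}$ and $\overline{t'}\in\overline{\mathcal F}$. For $\eta\in\widetilde{\mathbb E}(C,A)$ let $\eta_\sharp:\widetilde{\mathcal C}(-,C)\to\widetilde{\mathbb E}(-,A)$, $\gamma\mapsto\gamma^*\eta$, and $\eta^\sharp:\widetilde{\mathcal C}(A,-)\to\widetilde{\mathbb E}(C,-)$,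 $\alpha\mapsto\alpha_*\eta$. A sequence $A_0\xrightarrow{\alpha_0}A_1\to\cdots\xrightarrow{\alpha_n}A_{n+1}$ in $\widetilde{\mathcal C}$ is called a *weak kernel-cokernel sequence* if $$\widetilde{\mathcal C}(-,A_0)\to\widetilde{\mathcal C}(-,A_1)\to\cdots\to\widetilde{\mathcal C}(-,A_{n+1})\quad\text{and}\quad\widetilde{\mathcal C}(A_{n+1},-)\to\widetilde{\mathcal C}(A_n,-)\to\cdots\to\widetilde{\mathcal C}(A_0,-)$$ are exact (at the inner terms). **Proposition.** Assume that for every distinguished $n$-exangle $\langle X_\bullet,\delta\rangle$ in $\mathcal C$ the sequence $Q(X_\bullet)$ is a weak kernel-cokernel sequence in $\widetilde{\mathcal C}$. Let $[\overline t\backslash\overline\delta/\overline s]\in\widetilde{\mathbb E}(C,A)$ be any $\widetilde{\mathbb E}$-extension, where $s\in\mathcal F(A,X_0)$, $t\in\mathcal F(X_{n+1},C)$ and $\delta\in\mathbb E(X_{n+1},X_0)$, and let $$\mathfrak s(\delta)=[X_0\xrightarrow{x_0}X_1\xrightarrow{x_1}\cdots\xrightarrow{x_{n-1}}X_n\xrightarrow{x_n}X_{n+1}].$$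 Let $A\to X_1\to\cdots\to X_n\to C$ be the sequence in $\widetilde{\mathcal C}$ with maps $Q(x_0\circ s),Q(x_1),\dots,Q(x_{n-1}),Q(t\circ x_n)$. Then the following sequences are exact: (1) $\displaystyle\widetilde{\mathcal C}(-,A)\xrightarrow{Q(x_0 s)\circ-}\widetilde{\mathcal C}(-,X_1)\xrightarrow{Q(x_1)\circ-}\cdots\xrightarrow{Q(x_{n-1})\circ-}\widetilde{\mathcal C}(-,X_n)\xrightarrow{Q(t x_n)\circ-}\widetilde{\mathcal C}(-,C)\xrightarrow{[\overline t\backslash\overline\delta/\overline s]_\sharp}\widetilde{\mathbb E}(-,A);$ (2) $\displaystyle\widetilde{\mathcal C}(C,-)\xrightarrow{-\circ Q(t x_n)}\widetilde{\mathcal C}(X_n,-)\xrightarrow{-\circ Q(x_{n-1})}\cdots\xrightarrow{-\circ Q(x_1)}\widetilde{\mathcal C}(X_1,-)\xrightarrow{-\circ Q(x_0 s)}\widetilde{\mathcal C}(A,-)\xrightarrow{[\overline t\backslash\overline\delta/\overline s]^\sharp}\widetilde{\mathbb E}(C,-).$ -/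

import Mathlib

open CategoryTheory CategoryTheory.Limits Opposite

universe w v u

set_option linter.unusedSectionVars false

namespace NExLoc

section Bifunctor

variable {𝒟 : Type u} [Category.{v} 𝒟]

/-- `E(C, A)`, the group of extensions of `C` by `A`. -/
abbrev Ext (E : 𝒟ᵒᵖ ⥤ 𝒟 ⥤ AddCommGrpCat.{w}) (C A : 𝒟) : Type w :=
  ((E.obj (op C)).obj A : Type w)

variable (E : 𝒟ᵒᵖ ⥤ 𝒟 ⥤ AddCommGrpCat.{w})

/-- `δ ↦ a_* δ`. -/
def push {C A A' : 𝒟} (a : A ⟶ A') : Ext E C A →+ Ext E C A' :=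
  ((E.obj (op C)).map a).hom

/-- `δ ↦ c^* δ`. -/
def pull {C C' A : 𝒟} (c : C' ⟶ C) : Ext E C A →+ Ext E C' A :=
  ((E.map c.op).app A).hom

lemma push_id {C A : 𝒟} (δ : Ext E C A) : push E (𝟙 A) δ = δ := by
  simp [push]

lemma push_comp {C A A' A'' : 𝒟} (a : A ⟶ A') (a' : A' ⟶ A'') (δ : Ext E C A) :
    push E (a ≫ a') δ = push E a' (push E a δ) := by
  simp [push]

lemma pull_id {C A : 𝒟} (δ : Ext E C A) : pull E (𝟙 C) δ = δ := by
  simp [pull]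

lemma pull_comp {C C' C'' A : 𝒟} (c : C' ⟶ C) (c' : C'' ⟶ C') (δ : Ext E C A) :
    pull E (c' ≫ c) δ = pull E c' (pull E c δ) := by
  simp [pull]

lemma pull_push {C C' A A' : 𝒟} (c : C' ⟶ C) (a : A ⟶ A') (δ : Ext E C A) :
    pull E c (push E a δ) = push E a (pull E c δ) :=
  ConcreteCategory.congr_hom ((E.map c.op).naturality a) δ

end Bifunctor

section Fractions

variable {𝒟 : Type u} [Category.{v} 𝒟] (W : MorphismProperty 𝒟)

/-- A denominator for triples: `C ⟸ Z` and `X ⟸ A` with both arrows in `W`. -/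
structure Den (C A : 𝒟) where
  Z : 𝒟
  X : 𝒟
  t : Z ⟶ C
  ht : W t
  s : A ⟶ X
  hs : W s

/-- A refinement of denominators. -/
@[ext]
structure Den.Hom {W : MorphismProperty 𝒟} {C A : 𝒟} (d d' : Den W C A) where
  v : d'.Z ⟶ d.Z
  hv : W v
  u : d.X ⟶ d'.X
  hu : W u
  v_t : v ≫ d.t = d'.t
  s_u : d.s ≫ u = d'.s

instance [W.IsMultiplicative] (C A : 𝒟) : Category (Den W C A) where
  Hom d d' := Den.Hom d d'
  id d := ⟨𝟙 _, W.id_mem _, 𝟙 _, W.id_mem _, by simp, by simp⟩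
  comp f g := ⟨g.v ≫ f.v, W.comp_mem _ _ g.hv f.hv, f.u ≫ g.u, W.comp_mem _ _ f.hu g.hu,
    by rw [Category.assoc, f.v_t, g.v_t], by rw [← Category.assoc, f.s_u, g.s_u]⟩
  id_comp f := by apply Den.Hom.ext <;> simp
  comp_id f := by apply Den.Hom.ext <;> simp
  assoc f g h := by apply Den.Hom.ext <;> simp

section
variable {W}

lemma Den.hom_ext [W.IsMultiplicative] {C A : 𝒟} {d d' : Den W C A} {f g : d ⟶ d'}
    (hv : f.v = g.v) (hu : f.u = g.u) : f = g := Den.Hom.ext hv hu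

/-- Ore square for a cospan with one leg in `W`. -/
lemma ore_right [W.HasRightCalculusOfFractions] {C C' Z : 𝒟} (t : Z ⟶ C) (ht : W t)
    (c : C' ⟶ C) : ∃ (Z' : 𝒟) (t' : Z' ⟶ C') (_ : W t') (c' : Z' ⟶ Z), c' ≫ t = t' ≫ c := by
  obtain ⟨ψ, h⟩ := (MorphismProperty.LeftFraction.mk c t ht).exists_rightFraction
  exact ⟨_, ψ.s, ψ.hs, ψ.f, h.symm⟩

/-- Ore square for a span with one leg in `W`. -/
lemma ore_left [W.HasLeftCalculusOfFractions] {A A' X : 𝒟} (s : A ⟶ X) (hs : W s)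
    (a : A ⟶ A') : ∃ (X' : 𝒟) (s' : A' ⟶ X') (_ : W s') (a' : X ⟶ X'), s ≫ a' = a ≫ s' := by
  obtain ⟨ψ, h⟩ := (MorphismProperty.RightFraction.mk s hs a).exists_leftFraction
  exact ⟨_, ψ.s, ψ.hs, ψ.f, h.symm⟩

end

variable [W.HasLeftCalculusOfFractions] [W.HasRightCalculusOfFractions]
  [W.HasTwoOutOfThreeProperty]

instance (C A : 𝒟) : IsFilteredOrEmpty (Den W C A) where
  cocone_objs d d' := by
    obtain ⟨Z, b, hb, a, hZ⟩ := ore_right d.t d.ht d'.t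
    obtain ⟨X, b', hb', a', hX⟩ := ore_left d.s d.hs d'.s
    have ha : W a := W.of_postcomp a d.t d.ht (hZ ▸ W.comp_mem _ _ hb d'.ht)
    have ha' : W a' := W.of_precomp d.s a' d.hs (hX ▸ W.comp_mem _ _ d'.hs hb')
    exact ⟨⟨Z, X, b ≫ d'.t, W.comp_mem _ _ hb d'.ht, d'.s ≫ b', W.comp_mem _ _ d'.hs hb'⟩,
      ⟨a, ha, a', ha', hZ, hX⟩, ⟨b, hb, b', hb', rfl, rfl⟩, trivial⟩
  cocone_maps d d' f g := by
    obtain ⟨Z, w, hw, h1⟩ := MorphismProperty.HasRightCalculusOfFractions.ext f.v g.v d.t d.ht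
      (f.v_t.trans g.v_t.symm)
    obtain ⟨X, w', hw', h2⟩ := MorphismProperty.HasLeftCalculusOfFractions.ext f.u g.u d.s d.hs
      (f.s_u.trans g.s_u.symm)
    exact ⟨⟨Z, X, w ≫ d'.t, W.comp_mem _ _ hw d'.ht, d'.s ≫ w', W.comp_mem _ _ d'.hs hw'⟩,
      ⟨w, hw, w', hw', rfl, rfl⟩, Den.hom_ext h1 h2⟩

variable (E : 𝒟ᵒᵖ ⥤ 𝒟 ⥤ AddCommGrpCat.{w})

/-- A triple `(t \ δ / s)`, i.e. `C ⟸ Z ⇢ X ⟸ A` with `t, s ∈ W` and `δ ∈ E(Z, X)`. -/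
structure Triple (C A : 𝒟) where
  den : Den W C A
  δ : Ext E den.Z den.X

variable {W}

/-- `δ ↦ v^* u_* δ` along a refinement of denominators. -/
def res {C A : 𝒟} {d d' : Den W C A} (f : d ⟶ d') : Ext E d.Z d.X →+ Ext E d'.Z d'.X :=
  (pull E f.v).comp (push E f.u)

lemma res_id {C A : 𝒟} (d : Den W C A) (δ : Ext E d.Z d.X) : res E (𝟙 d) δ = δ :=
  (pull_id E _).trans (push_id E _)

lemma res_comp {C A : 𝒟} {d d' d'' : Den W C A} (f : d ⟶ d') (g : d' ⟶ d'')
    (δ : Ext E d.Z d.X) : res E (f ≫ g) δ = res E g (res E f δ) := by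
  change pull E (g.v ≫ f.v) (push E (f.u ≫ g.u) δ) =
    pull E g.v (push E g.u (pull E f.v (push E f.u δ)))
  rw [pull_comp, push_comp, ← pull_push]

variable (W)

/-- Two triples are equivalent iff they agree over some common denominator. -/
def Triple.setoid (C A : 𝒟) : Setoid (Triple W E C A) where
  r T T' := ∃ (k : Den W C A) (f : T.den ⟶ k) (g : T'.den ⟶ k), res E f T.δ = res E g T'.δ
  iseqv :=
    { refl T := ⟨_, 𝟙 _, 𝟙 _, rfl⟩
      symm := fun ⟨k, f, g, h⟩ => ⟨k, g, f, h.symm⟩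
      trans := by
        rintro T₁ T₂ T₃ ⟨k, f, g, h⟩ ⟨k', f', g', h'⟩
        obtain ⟨l, a, b, e⟩ := IsFilteredOrEmpty.cocone_objs k k'
        obtain ⟨m, c, hc⟩ := IsFilteredOrEmpty.cocone_maps (g ≫ a) (f' ≫ b)
        refine ⟨m, f ≫ a ≫ c, g' ≫ b ≫ c, ?_⟩
        rw [res_comp, h, ← res_comp, ← Category.assoc, hc, res_comp E g', ← h', ← res_comp,
          ← Category.assoc] }

/-- The underlying set of `Ẽ(C, A)`. -/
def TExt (C A : 𝒟) : Type (max u v w) := Quotient (Triple.setoid W E C A)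

variable {W}

/-- The class `[t \ δ / s]`, with the denominator as an argument. -/
def TExt.mk {C A : 𝒟} (d : Den W C A) (δ : Ext E d.Z d.X) : TExt W E C A :=
  Quotient.mk (Triple.setoid W E C A) ⟨d, δ⟩

namespace TExt

variable {E}

lemma mk_res {C A : 𝒟} {d d' : Den W C A} (f : d ⟶ d') (δ : Ext E d.Z d.X) :
    mk E d' (res E f δ) = mk E d δ :=
  Quotient.sound ⟨d', 𝟙 _, f, res_id E _ _⟩

lemma mk_eq_iff {C A : 𝒟} {d d' : Den W C A} (δ : Ext E d.Z d.X) (δ' : Ext E d'.Z d'.X) :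
    mk E d δ = mk E d' δ' ↔ ∃ (k : Den W C A) (f : d ⟶ k) (g : d' ⟶ k),
      res E f δ = res E g δ' :=
  ⟨fun h => Quotient.exact h, fun h => Quotient.sound h⟩

lemma exists_rep {C A : 𝒟} (x : TExt W E C A) : ∃ d δ, mk E d δ = x := by
  obtain ⟨⟨d, δ⟩, rfl⟩ := Quotient.exists_rep x
  exact ⟨d, δ, rfl⟩

lemma exists_rep₂ {C A : 𝒟} (x y : TExt W E C A) :
    ∃ d δ ε, mk E d δ = x ∧ mk E d ε = y := by
  obtain ⟨d, δ, rfl⟩ := exists_rep x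
  obtain ⟨d', ε, rfl⟩ := exists_rep y
  obtain ⟨k, f, g, -⟩ := IsFilteredOrEmpty.cocone_objs d d'
  exact ⟨k, _, _, mk_res f _, mk_res g _⟩

lemma exists_rep₃ {C A : 𝒟} (x y z : TExt W E C A) :
    ∃ d δ ε ζ, mk E d δ = x ∧ mk E d ε = y ∧ mk E d ζ = z := by
  obtain ⟨d, δ, ε, rfl, rfl⟩ := exists_rep₂ x y
  obtain ⟨d', ζ, rfl⟩ := exists_rep z
  obtain ⟨k, f, g, -⟩ := IsFilteredOrEmpty.cocone_objs d d'
  exact ⟨k, _, _, _, mk_res f _, mk_res f _, mk_res g _⟩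

/-- A function out of `TExt` is a function on triples compatible with refinements. -/
def lift {C A : 𝒟} {β : Type*} (φ : ∀ d : Den W C A, Ext E d.Z d.X → β)
    (hφ : ∀ {d d' : Den W C A} (f : d ⟶ d') (δ), φ d' (res E f δ) = φ d δ)
    (x : TExt W E C A) : β :=
  Quotient.lift (fun T : Triple W E C A => φ T.den T.δ)
    (by
      rintro ⟨d, δ⟩ ⟨d', δ'⟩ ⟨k, f, g, h⟩
      exact (hφ f δ).symm.trans ((congrArg (φ k) h).trans (hφ g δ'))) x

/-- Addition of fractions: reduce to a common denominator, then add. -/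
noncomputable def addTriple {C A : 𝒟} (d d' : Den W C A) (δ : Ext E d.Z d.X)
    (δ' : Ext E d'.Z d'.X) : TExt W E C A :=
  mk E (IsFiltered.max d d')
    (res E (IsFiltered.leftToMax d d') δ + res E (IsFiltered.rightToMax d d') δ')

lemma addTriple_eq {C A : 𝒟} {d d' k : Den W C A} (δ : Ext E d.Z d.X)
    (δ' : Ext E d'.Z d'.X) (f : d ⟶ k) (g : d' ⟶ k) :
    addTriple d d' δ δ' = mk E k (res E f δ + res E g δ') := by
  obtain ⟨s, α, β, h1, h2⟩ := IsFiltered.bowtie (IsFiltered.leftToMax d d') f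
    (IsFiltered.rightToMax d d') g
  rw [addTriple, ← mk_res α, ← mk_res β, map_add, map_add, ← res_comp, ← res_comp, ← res_comp,
    ← res_comp, h1, h2]

noncomputable instance (C A : 𝒟) : Add (TExt W E C A) where
  add x y := lift (fun d δ => lift (fun d' δ' => addTriple d d' δ δ')
    (by
      intro d' d'' g δ'
      obtain ⟨k, a, b, -⟩ := IsFilteredOrEmpty.cocone_objs d d''
      rw [addTriple_eq _ _ a b, addTriple_eq _ _ a (g ≫ b), res_comp]) y)
    (by
      intro d d'' f δ
      obtain ⟨d', δ', rfl⟩ := exists_rep y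
      change addTriple _ _ _ _ = addTriple _ _ _ _
      obtain ⟨k, a, b, -⟩ := IsFilteredOrEmpty.cocone_objs d'' d'
      rw [addTriple_eq _ _ a b, addTriple_eq _ _ (f ≫ a) b, res_comp]) x

lemma mk_add {C A : 𝒟} (d : Den W C A) (δ δ' : Ext E d.Z d.X) :
    mk E d δ + mk E d δ' = mk E d (δ + δ') := by
  change addTriple _ _ _ _ = _
  rw [addTriple_eq _ _ (𝟙 d) (𝟙 d), res_id, res_id]

variable (W) in
/-- The denominator `C ⟸ C`, `A ⟸ A` given by identities. -/
abbrev _root_.NExLoc.Den.id (C A : 𝒟) : Den W C A :=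
  ⟨C, A, 𝟙 C, W.id_mem _, 𝟙 A, W.id_mem _⟩

/-- The refinement from the identity denominator. -/
def _root_.NExLoc.Den.fromId {C A : 𝒟} (d : Den W C A) : Den.id W C A ⟶ d :=
  ⟨d.t, d.ht, d.s, d.hs, Category.comp_id _, Category.id_comp _⟩

noncomputable instance (C A : 𝒟) : Zero (TExt W E C A) := ⟨mk E (Den.id W C A) 0⟩

lemma mk_zero {C A : 𝒟} (d : Den W C A) : mk E d 0 = 0 := by
  change _ = mk E (Den.id W C A) 0
  rw [← mk_res d.fromId, map_zero]

noncomputable instance (C A : 𝒟) : Neg (TExt W E C A) where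
  neg := lift (fun d δ => mk E d (-δ)) (by
    intro d d' f δ
    rw [← map_neg, mk_res])

noncomputable instance (C A : 𝒟) : AddCommGroup (TExt W E C A) where
  add_assoc x y z := by
    obtain ⟨d, δ, ε, ζ, rfl, rfl, rfl⟩ := exists_rep₃ x y z
    simp only [mk_add, add_assoc]
  zero_add x := by
    obtain ⟨d, δ, rfl⟩ := exists_rep x
    rw [← mk_zero d, mk_add, zero_add]
  add_zero x := by
    obtain ⟨d, δ, rfl⟩ := exists_rep x
    rw [← mk_zero d, mk_add, add_zero]
  add_comm x y := by
    obtain ⟨d, δ, ε, rfl, rfl⟩ := exists_rep₂ x y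
    simp only [mk_add, add_comm]
  neg_add_cancel x := by
    obtain ⟨d, δ, rfl⟩ := exists_rep x
    change mk E d (-δ) + mk E d δ = 0
    rw [mk_add, neg_add_cancel, mk_zero]
  nsmul := nsmulRec
  zsmul := zsmulRec


/-- Replace the left half of a denominator. -/
abbrev _root_.NExLoc.Den.setT {C C' A : 𝒟} (d : Den W C A) {Z' : 𝒟} (t' : Z' ⟶ C') (ht' : W t') :
    Den W C' A := ⟨Z', d.X, t', ht', d.s, d.hs⟩

/-- Replace the right half of a denominator. -/
abbrev _root_.NExLoc.Den.setS {C A A' : 𝒟} (d : Den W C A) {X' : 𝒟} (s' : A' ⟶ X') (hs' : W s') :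
    Den W C A' := ⟨d.Z, X', d.t, d.ht, s', hs'⟩

/-- Independence of the chosen square in the definition of `c^*`. -/
lemma pull_aux {C C' A : 𝒟} (c : C' ⟶ C) (d : Den W C A) (δ : Ext E d.Z d.X)
    {Z₁ Z₂ : 𝒟} (t₁ : Z₁ ⟶ C') (h₁ : W t₁) (c₁ : Z₁ ⟶ d.Z) (e₁ : c₁ ≫ d.t = t₁ ≫ c)
    (t₂ : Z₂ ⟶ C') (h₂ : W t₂) (c₂ : Z₂ ⟶ d.Z) (e₂ : c₂ ≫ d.t = t₂ ≫ c) :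
    mk E (d.setT t₁ h₁) (pull E c₁ δ) = mk E (d.setT t₂ h₂) (pull E c₂ δ) := by
  obtain ⟨Z, b, hb, a, hZ⟩ := ore_right t₁ h₁ t₂
  have ha : W a := W.of_postcomp a t₁ h₁ (hZ ▸ W.comp_mem _ _ hb h₂)
  obtain ⟨Z', w, hw, e⟩ := MorphismProperty.HasRightCalculusOfFractions.ext (a ≫ c₁) (b ≫ c₂)
    d.t d.ht (by rw [Category.assoc, Category.assoc, e₁, e₂, reassoc_of% hZ])
  have hwa := W.comp_mem _ _ hw ha
  have hwb := W.comp_mem _ _ hw hb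
  refine (mk_eq_iff _ _).2 ⟨⟨Z', d.X, (w ≫ a) ≫ t₁, W.comp_mem _ _ hwa h₁, d.s, d.hs⟩,
    ⟨w ≫ a, hwa, 𝟙 _, W.id_mem _, rfl, Category.comp_id _⟩,
    ⟨w ≫ b, hwb, 𝟙 _, W.id_mem _, by simpa using congrArg (w ≫ ·) hZ.symm, Category.comp_id _⟩, ?_⟩
  change pull E (w ≫ a) (push E (𝟙 _) (pull E c₁ δ)) =
    pull E (w ≫ b) (push E (𝟙 _) (pull E c₂ δ))
  rw [push_id, push_id, ← pull_comp, ← pull_comp, Category.assoc, Category.assoc, e]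

/-- Independence of the chosen square in the definition of `a_*`. -/
lemma push_aux {C A A' : 𝒟} (a : A ⟶ A') (d : Den W C A) (δ : Ext E d.Z d.X)
    {X₁ X₂ : 𝒟} (s₁ : A' ⟶ X₁) (h₁ : W s₁) (a₁ : d.X ⟶ X₁) (e₁ : d.s ≫ a₁ = a ≫ s₁)
    (s₂ : A' ⟶ X₂) (h₂ : W s₂) (a₂ : d.X ⟶ X₂) (e₂ : d.s ≫ a₂ = a ≫ s₂) :
    mk E (d.setS s₁ h₁) (push E a₁ δ) = mk E (d.setS s₂ h₂) (push E a₂ δ) := by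
  obtain ⟨X, b, hb, c, hX⟩ := ore_left s₁ h₁ s₂
  have hc : W c := W.of_precomp s₁ c h₁ (hX ▸ W.comp_mem _ _ h₂ hb)
  obtain ⟨X', w, hw, e⟩ := MorphismProperty.HasLeftCalculusOfFractions.ext (a₁ ≫ c) (a₂ ≫ b)
    d.s d.hs (by rw [reassoc_of% e₁, reassoc_of% e₂, hX])
  have hcw := W.comp_mem _ _ hc hw
  have hbw := W.comp_mem _ _ hb hw
  refine (mk_eq_iff _ _).2 ⟨⟨d.Z, X', d.t, d.ht, s₁ ≫ c ≫ w, W.comp_mem _ _ h₁ hcw⟩,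
    ⟨𝟙 _, W.id_mem _, c ≫ w, hcw, Category.id_comp _, rfl⟩,
    ⟨𝟙 _, W.id_mem _, b ≫ w, hbw, Category.id_comp _, by simpa using congrArg (· ≫ w) hX.symm⟩, ?_⟩
  change pull E (𝟙 _) (push E (c ≫ w) (push E a₁ δ)) =
    pull E (𝟙 _) (push E (b ≫ w) (push E a₂ δ))
  rw [pull_id, pull_id, ← push_comp, ← push_comp, ← Category.assoc, ← Category.assoc, e]

lemma exists_pullSquare {C C' A : 𝒟} (c : C' ⟶ C) (d : Den W C A) :
    ∃ (Z' : 𝒟) (t' : Z' ⟶ C') (_ : W t') (c' : Z' ⟶ d.Z), c' ≫ d.t = t' ≫ c :=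
  ore_right d.t d.ht c

lemma exists_pushSquare {C A A' : 𝒟} (a : A ⟶ A') (d : Den W C A) :
    ∃ (X' : 𝒟) (s' : A' ⟶ X') (_ : W s') (a' : d.X ⟶ X'), d.s ≫ a' = a ≫ s' :=
  ore_left d.s d.hs a

/-- `c^* [t \ δ / s] = [t' \ c'^* δ / s]` for a chosen square `t ∘ c' = c ∘ t'`, `t' ∈ W`. -/
noncomputable def pullFun {C C' A : 𝒟} (c : C' ⟶ C) : TExt W E C A → TExt W E C' A :=
  lift (fun d δ => mk E (d.setT _ (exists_pullSquare c d).choose_spec.choose_spec.choose)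
      (pull E (exists_pullSquare c d).choose_spec.choose_spec.choose_spec.choose δ))
    (by
      intro d d' f δ
      obtain ⟨Z, t, ht, c', e⟩ := exists_pullSquare c d'
      rw [pull_aux c d' _ _ _ _ (exists_pullSquare c d').choose_spec.choose_spec.choose_spec.choose_spec
          t ht c' e,
        pull_aux c d _ _ _ _ (exists_pullSquare c d).choose_spec.choose_spec.choose_spec.choose_spec
          t ht (c' ≫ f.v) (by rw [Category.assoc, f.v_t, e])]
      rw [← mk_res (d := d.setT t ht) (d' := d'.setT t ht)
        ⟨𝟙 _, W.id_mem _, f.u, f.hu, Category.id_comp _, f.s_u⟩]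
      congr 1
      change pull E c' (pull E f.v (push E f.u δ)) =
        pull E (𝟙 _) (push E f.u (pull E (c' ≫ f.v) δ))
      rw [pull_id, ← pull_push, pull_comp])

/-- `a_* [t \ δ / s] = [t \ a'_* δ / s']` for a chosen square `a' ∘ s = s' ∘ a`, `s' ∈ W`. -/
noncomputable def pushFun {C A A' : 𝒟} (a : A ⟶ A') : TExt W E C A → TExt W E C A' :=
  lift (fun d δ => mk E (d.setS _ (exists_pushSquare a d).choose_spec.choose_spec.choose)
      (push E (exists_pushSquare a d).choose_spec.choose_spec.choose_spec.choose δ))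
    (by
      intro d d' f δ
      obtain ⟨X, s, hs, a', e⟩ := exists_pushSquare a d'
      rw [push_aux a d' _ _ _ _ (exists_pushSquare a d').choose_spec.choose_spec.choose_spec.choose_spec
          s hs a' e,
        push_aux a d _ _ _ _ (exists_pushSquare a d).choose_spec.choose_spec.choose_spec.choose_spec
          s hs (f.u ≫ a') (by rw [← Category.assoc, f.s_u, e])]
      rw [← mk_res (d := d.setS s hs) (d' := d'.setS s hs)
        ⟨f.v, f.hv, 𝟙 _, W.id_mem _, f.v_t, Category.comp_id _⟩]
      congr 1
      change push E a' (pull E f.v (push E f.u δ)) =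
        pull E f.v (push E (𝟙 _) (push E (f.u ≫ a') δ))
      rw [push_id, ← pull_push, push_comp])

lemma pullFun_mk {C C' A : 𝒟} (c : C' ⟶ C) (d : Den W C A) (δ : Ext E d.Z d.X)
    {Z : 𝒟} (t : Z ⟶ C') (ht : W t) (c' : Z ⟶ d.Z) (e : c' ≫ d.t = t ≫ c) :
    pullFun c (mk E d δ) = mk E (d.setT t ht) (pull E c' δ) :=
  pull_aux c d _ _ _ _ (exists_pullSquare c d).choose_spec.choose_spec.choose_spec.choose_spec
    t ht c' e

lemma pushFun_mk {C A A' : 𝒟} (a : A ⟶ A') (d : Den W C A) (δ : Ext E d.Z d.X)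
    {X : 𝒟} (s : A' ⟶ X) (hs : W s) (a' : d.X ⟶ X) (e : d.s ≫ a' = a ≫ s) :
    pushFun a (mk E d δ) = mk E (d.setS s hs) (push E a' δ) :=
  push_aux a d _ _ _ _ (exists_pushSquare a d).choose_spec.choose_spec.choose_spec.choose_spec
    s hs a' e

lemma pushFun_add {C A A' : 𝒟} (a : A ⟶ A') (x y : TExt W E C A) :
    pushFun a (x + y) = pushFun a x + pushFun a y := by
  obtain ⟨d, δ, ε, rfl, rfl⟩ := exists_rep₂ x y
  obtain ⟨X, s, hs, a', e⟩ := exists_pushSquare a d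
  rw [mk_add, pushFun_mk a d _ s hs a' e, pushFun_mk a d _ s hs a' e,
    pushFun_mk a d _ s hs a' e, map_add, mk_add]

lemma pullFun_add {C C' A : 𝒟} (c : C' ⟶ C) (x y : TExt W E C A) :
    pullFun c (x + y) = pullFun c x + pullFun c y := by
  obtain ⟨d, δ, ε, rfl, rfl⟩ := exists_rep₂ x y
  obtain ⟨Z, t, ht, c', e⟩ := exists_pullSquare c d
  rw [mk_add, pullFun_mk c d _ t ht c' e, pullFun_mk c d _ t ht c' e,
    pullFun_mk c d _ t ht c' e, map_add, mk_add]

lemma pushFun_id {C A : 𝒟} (x : TExt W E C A) : pushFun (𝟙 A) x = x := by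
  obtain ⟨d, δ, rfl⟩ := exists_rep x
  rw [pushFun_mk (𝟙 A) d δ d.s d.hs (𝟙 _) (by simp), push_id]

lemma pullFun_id {C A : 𝒟} (x : TExt W E C A) : pullFun (𝟙 C) x = x := by
  obtain ⟨d, δ, rfl⟩ := exists_rep x
  rw [pullFun_mk (𝟙 C) d δ d.t d.ht (𝟙 _) (by simp), pull_id]

lemma pushFun_comp {C A A' A'' : 𝒟} (a : A ⟶ A') (a' : A' ⟶ A'') (x : TExt W E C A) :
    pushFun (a ≫ a') x = pushFun a' (pushFun a x) := by
  obtain ⟨d, δ, rfl⟩ := exists_rep x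
  obtain ⟨X, s, hs, b, e⟩ := exists_pushSquare a d
  obtain ⟨X', s', hs', b', e'⟩ := ore_left s hs a'
  rw [pushFun_mk (a ≫ a') d δ s' hs' (b ≫ b') (by rw [reassoc_of% e, e', Category.assoc]),
    pushFun_mk a d δ s hs b e, pushFun_mk a' (d.setS s hs) _ s' hs' b' e', push_comp]

lemma pullFun_comp {C C' C'' A : 𝒟} (c : C' ⟶ C) (c' : C'' ⟶ C') (x : TExt W E C A) :
    pullFun (c' ≫ c) x = pullFun c' (pullFun c x) := by
  obtain ⟨d, δ, rfl⟩ := exists_rep x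
  obtain ⟨Z, t, ht, b, e⟩ := exists_pullSquare c d
  obtain ⟨Z', t', ht', b', e'⟩ := ore_right t ht c'
  rw [pullFun_mk (c' ≫ c) d δ t' ht' (b' ≫ b) (by rw [Category.assoc, e, reassoc_of% e']), pullFun_mk c d δ t ht b e, pullFun_mk c' (d.setT t ht) _ t' ht' b' e',
    pull_comp]

lemma pullFun_pushFun {C C' A A' : 𝒟} (c : C' ⟶ C) (a : A ⟶ A') (x : TExt W E C A) :
    pullFun c (pushFun a x) = pushFun a (pullFun c x) := by
  obtain ⟨d, δ, rfl⟩ := exists_rep x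
  obtain ⟨Z, t, ht, c', e⟩ := exists_pullSquare c d
  obtain ⟨X, s, hs, a', e'⟩ := exists_pushSquare a d
  rw [pushFun_mk a d δ s hs a' e', pullFun_mk c (d.setS s hs) _ t ht c' e,
    pullFun_mk c d δ t ht c' e, pushFun_mk a (d.setT t ht) _ s hs a' e', pull_push]

lemma pullFun_bijective {C C' A : 𝒟} (c : C' ⟶ C) (hc : W c) :
    Function.Bijective (pullFun (W := W) (E := E) (A := A) c) := by
  constructor
  · intro x y h
    obtain ⟨d, δ, ε, rfl, rfl⟩ := exists_rep₂ x y
    obtain ⟨Z, t, ht, c', e⟩ := exists_pullSquare c d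
    rw [pullFun_mk c d _ t ht c' e, pullFun_mk c d _ t ht c' e] at h
    have hc' : W c' := W.of_postcomp c' d.t d.ht (e ▸ W.comp_mem _ _ ht hc)
    obtain ⟨k, f, g, hk⟩ := (mk_eq_iff _ _).1 h
    have hf : (f.v ≫ c') ≫ d.t = k.t ≫ c := by
      rw [Category.assoc, e, ← f.v_t, Category.assoc]
    have hg : (g.v ≫ c') ≫ d.t = k.t ≫ c := by
      rw [Category.assoc, e, ← g.v_t, Category.assoc]
    refine (mk_eq_iff _ _).2 ⟨⟨k.Z, k.X, k.t ≫ c, W.comp_mem _ _ k.ht hc, k.s, k.hs⟩,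
      ⟨f.v ≫ c', W.comp_mem _ _ f.hv hc', f.u, f.hu, hf, f.s_u⟩,
      ⟨g.v ≫ c', W.comp_mem _ _ g.hv hc', g.u, g.hu, hg, g.s_u⟩, ?_⟩
    change pull E (f.v ≫ c') (push E f.u δ) = pull E (g.v ≫ c') (push E g.u ε)
    rw [pull_comp, pull_comp, pull_push E c', pull_push E c']
    exact hk
  · intro y
    obtain ⟨d, δ, rfl⟩ := exists_rep y
    refine ⟨mk E (d.setT (d.t ≫ c) (W.comp_mem _ _ d.ht hc)) δ, ?_⟩
    rw [pullFun_mk c (d.setT (d.t ≫ c) (W.comp_mem _ _ d.ht hc)) δ d.t d.ht (𝟙 _) (by simp),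
      pull_id]

lemma pushFun_bijective {C A A' : 𝒟} (a : A ⟶ A') (ha : W a) :
    Function.Bijective (pushFun (W := W) (E := E) (C := C) a) := by
  constructor
  · intro x y h
    obtain ⟨d, δ, ε, rfl, rfl⟩ := exists_rep₂ x y
    obtain ⟨X, s, hs, a', e⟩ := exists_pushSquare a d
    rw [pushFun_mk a d _ s hs a' e, pushFun_mk a d _ s hs a' e] at h
    have ha' : W a' := W.of_precomp d.s a' d.hs (e ▸ W.comp_mem _ _ ha hs)
    obtain ⟨k, f, g, hk⟩ := (mk_eq_iff _ _).1 h
    have hf : d.s ≫ a' ≫ f.u = a ≫ k.s := by rw [reassoc_of% e, ← f.s_u]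
    have hg : d.s ≫ a' ≫ g.u = a ≫ k.s := by rw [reassoc_of% e, ← g.s_u]
    refine (mk_eq_iff _ _).2 ⟨⟨k.Z, k.X, k.t, k.ht, a ≫ k.s, W.comp_mem _ _ ha k.hs⟩,
      ⟨f.v, f.hv, a' ≫ f.u, W.comp_mem _ _ ha' f.hu, f.v_t, hf⟩,
      ⟨g.v, g.hv, a' ≫ g.u, W.comp_mem _ _ ha' g.hu, g.v_t, hg⟩, ?_⟩
    change pull E f.v (push E (a' ≫ f.u) δ) = pull E g.v (push E (a' ≫ g.u) ε)
    rw [push_comp, push_comp]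
    exact hk
  · intro y
    obtain ⟨d, δ, rfl⟩ := exists_rep y
    refine ⟨mk E (d.setS (a ≫ d.s) (W.comp_mem _ _ ha d.hs)) δ, ?_⟩
    rw [pushFun_mk a (d.setS (a ≫ d.s) (W.comp_mem _ _ ha d.hs)) δ d.s d.hs (𝟙 _) (by simp),
      push_id]

variable (W E)

/-- `Ẽ` as a bifunctor on the category before localization. -/
noncomputable def functor₀ : 𝒟ᵒᵖ ⥤ 𝒟 ⥤ AddCommGrpCat.{max u v w} where
  obj C :=
    { obj := fun A => AddCommGrpCat.of (TExt W E C.unop A)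
      map := fun a => AddCommGrpCat.ofHom (AddMonoidHom.mk' (pushFun a) (pushFun_add a))
      map_id := fun A => by ext x; exact pushFun_id x
      map_comp := fun a a' => by ext x; exact pushFun_comp a a' x }
  map c :=
    { app := fun A => AddCommGrpCat.ofHom (AddMonoidHom.mk' (pullFun c.unop) (pullFun_add c.unop))
      naturality := fun A A' a => by ext x; exact pullFun_pushFun c.unop a x }
  map_id C := by ext A x; exact pullFun_id x
  map_comp c c' := by ext A x; exact pullFun_comp c.unop c'.unop x

variable {W}

lemma isIso_map {C C' : 𝒟ᵒᵖ} (c : C ⟶ C') (hc : W c.unop) :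
    IsIso ((functor₀ W E).map c) := by
  have : ∀ A, IsIso (((functor₀ W E).map c).app A) := fun A =>
    (ConcreteCategory.isIso_iff_bijective _).2 (pullFun_bijective c.unop hc)
  exact NatIso.isIso_of_isIso_app _

lemma isIso_obj_map (C : 𝒟ᵒᵖ) {A A' : 𝒟} (a : A ⟶ A') (ha : W a) :
    IsIso (((functor₀ W E).obj C).map a) :=
  (ConcreteCategory.isIso_iff_bijective _).2 (pushFun_bijective a ha)

variable (W)

/-- Extension of `functor₀` to the localized category in the covariant variable. -/
noncomputable def functor₁ : 𝒟ᵒᵖ ⥤ W.Localization ⥤ AddCommGrpCat.{max u v w} :=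
  (Localization.Construction.lift (W := W) (functor₀ W E).flip (fun _ _ a ha => by
    have : ∀ C, IsIso (((functor₀ W E).flip.map a).app C) := fun C => isIso_obj_map E C a ha
    exact NatIso.isIso_of_isIso_app _)).flip

lemma functor₁_obj_map (C : 𝒟ᵒᵖ) {A A' : 𝒟} (a : A ⟶ A') :
    ((functor₁ W E).obj C).map (W.Q.map a) = ((functor₀ W E).obj C).map a := by
  have := Functor.congr_hom (Localization.Construction.fac (W := W) (functor₀ W E).flip
    (fun _ _ a ha => by
      have : ∀ C, IsIso (((functor₀ W E).flip.map a).app C) := fun C => isIso_obj_map E C a ha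
      exact NatIso.isIso_of_isIso_app _)) a
  exact (congrArg (fun f => NatTrans.app f C) this).trans
    ((Category.id_comp _).trans (Category.comp_id _))

lemma functor₁_map_app {C C' : 𝒟ᵒᵖ} (c : C ⟶ C') (A : 𝒟) :
    ((functor₁ W E).map c).app (W.Q.obj A) = ((functor₀ W E).map c).app A := rfl

lemma isIso_functor₁_map {C C' : 𝒟ᵒᵖ} (c : C ⟶ C') (hc : W c.unop) :
    IsIso ((functor₁ W E).map c) := by
  have : ∀ A, IsIso (((functor₁ W E).map c).app A) := by
    intro A
    obtain ⟨A, rfl⟩ := (Localization.Construction.objEquiv W).surjective A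
    have := isIso_map E c hc
    exact inferInstanceAs (IsIso (((functor₀ W E).map c).app A))
  exact NatIso.isIso_of_isIso_app _

/-- The localized bifunctor `Ẽ : D̃ᵒᵖ × D̃ → Ab`: the unique extension of `functor₀` along the
localization functor, in both variables. -/
noncomputable def functor : W.Localizationᵒᵖ ⥤ W.Localization ⥤ AddCommGrpCat.{max u v w} :=
  (Localization.Construction.lift (W := W) (functor₁ W E).rightOp (fun C' C c hc => by
    have := isIso_functor₁_map W E c.op hc
    exact inferInstanceAs (IsIso ((functor₁ W E).map c.op).op))).leftOp

/-- The values of `Ẽ` are the groups of classes `[t \ δ / s]`. -/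
noncomputable def toExt {C A : 𝒟} : TExt W E C A ≃+ Ext (functor W E) (W.Q.obj C) (W.Q.obj A) :=
  AddEquiv.refl (TExt W E C A)

variable {W}

lemma pull_functor {C C' A : 𝒟} (c : C' ⟶ C) (x : TExt W E C A) :
    pull (functor W E) (W.Q.map c) (toExt W E x) = toExt W E (pullFun c x) := by
  have h := Functor.congr_hom (Localization.Construction.fac (W := W) (functor₁ W E).rightOp
    (fun C' C c hc => by
      have := isIso_functor₁_map W E c.op hc
      exact inferInstanceAs (IsIso ((functor₁ W E).map c.op).op))) c
  have h' := congrArg Quiver.Hom.unop (h.trans ((Category.id_comp _).trans (Category.comp_id _)))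
  exact ConcreteCategory.congr_hom (congrArg (fun f => NatTrans.app f (W.Q.obj A)) h') x

lemma push_functor {C A A' : 𝒟} (a : A ⟶ A') (x : TExt W E C A) :
    push (functor W E) (W.Q.map a) (toExt W E x) = toExt W E (pushFun a x) :=
  ConcreteCategory.congr_hom (functor₁_obj_map W E (op C) a) x

/-- The action of `γ = Q(c) ∘ Q(v)⁻¹` on `Ẽ(-, A)`:
`γ^* [t \ δ / s] = [v ∘ t' \ c'^* δ / s]` for any square `t ∘ c' = c ∘ t'` with `t' ∈ W`. -/
lemma pull_frac {B C C' A : 𝒟} (d : Den W C A) (δ : Ext E d.Z d.X)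
    (γ : W.Q.obj C' ⟶ W.Q.obj C) (v : B ⟶ C') (hv : W v) (c : B ⟶ C)
    (hγ : W.Q.map v ≫ γ = W.Q.map c)
    {Z : 𝒟} (t : Z ⟶ B) (ht : W t) (c' : Z ⟶ d.Z) (e : c' ≫ d.t = t ≫ c) :
    pull (functor W E) γ (toExt W E (mk E d δ)) =
      toExt W E (mk E (d.setT (t ≫ v) (W.comp_mem _ _ ht hv)) (pull E c' δ)) := by
  have : Function.Injective (pull (A := W.Q.obj A) (functor W E) (W.Q.map v)) := by
    intro x y h
    obtain ⟨x, rfl⟩ := (toExt W E).surjective x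
    obtain ⟨y, rfl⟩ := (toExt W E).surjective y
    rw [pull_functor, pull_functor] at h
    rw [(pullFun_bijective v hv).1 ((toExt W E).injective h)]
  apply this
  rw [← pull_comp, hγ, pull_functor, pull_functor, pullFun_mk c d δ t ht c' e,
    pullFun_mk v (d.setT (t ≫ v) (W.comp_mem _ _ ht hv)) _ t ht (𝟙 _) (by simp), pull_id]

/-- The action of `α = Q(u)⁻¹ ∘ Q(a)` on `Ẽ(C, -)`:
`α_* [t \ δ / s] = [t \ a'_* δ / s' ∘ u]` for any square `a' ∘ s = s' ∘ a` with `s' ∈ W`. -/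
lemma push_frac {B C A A' : 𝒟} (d : Den W C A) (δ : Ext E d.Z d.X)
    (α : W.Q.obj A ⟶ W.Q.obj A') (u : A' ⟶ B) (hu : W u) (a : A ⟶ B)
    (hα : α ≫ W.Q.map u = W.Q.map a)
    {X : 𝒟} (s : B ⟶ X) (hs : W s) (a' : d.X ⟶ X) (e : d.s ≫ a' = a ≫ s) :
    push (functor W E) α (toExt W E (mk E d δ)) =
      toExt W E (mk E (d.setS (u ≫ s) (W.comp_mem _ _ hu hs)) (push E a' δ)) := by
  have : Function.Injective (push (C := W.Q.obj C) (functor W E) (W.Q.map u)) := by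
    intro x y h
    obtain ⟨x, rfl⟩ := (toExt W E).surjective x
    obtain ⟨y, rfl⟩ := (toExt W E).surjective y
    rw [push_functor, push_functor] at h
    rw [(pushFun_bijective u hu).1 ((toExt W E).injective h)]
  apply this
  rw [← push_comp, hα, push_functor, push_functor, pushFun_mk a d δ s hs a' e,
    pushFun_mk u (d.setS (u ≫ s) (W.comp_mem _ _ hu hs)) _ s hs (𝟙 _) (by simp), push_id]

end TExt
end Fractions

section Sequences

variable {𝒟 : Type u} [Category.{v} 𝒟] [Preadditive 𝒟]

/-- A complex `A → X₁ → ⋯ → Xₙ → C` of length `n + 2` with prescribed ends: a complex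
`X₀ → X₁ → ⋯ → Xₙ₊₁`, whose components vanish outside the degrees `0, …, n + 1`, together with
identifications of `X₀` with `A` and of `Xₙ₊₁` with `C`. -/
structure NSeq (n : ℕ) (A C : 𝒟) where
  X : CochainComplex 𝒟 ℕ
  isZero : ∀ i, n + 1 < i → IsZero (X.X i)
  left : X.X 0 ≅ A
  right : X.X (n + 1) ≅ C

namespace NSeq

variable {n : ℕ} {A A' C C' : 𝒟}

/-- The first map `x₀ : A → X₁`. -/
def first (S : NSeq n A C) : A ⟶ S.X.X 1 := S.left.inv ≫ S.X.d 0 1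

/-- The last map `xₙ : Xₙ → C`. -/
def last (S : NSeq n A C) : S.X.X n ⟶ C := S.X.d n (n + 1) ≫ S.right.hom

/-- A morphism of complexes is of the form `(a, f₁, …, fₙ, c)`. -/
def IsLift {S : NSeq n A C} {T : NSeq n A' C'} (f : S.X ⟶ T.X) (a : A ⟶ A') (c : C ⟶ C') : Prop :=
  f.f 0 ≫ T.left.hom = S.left.hom ≫ a ∧ f.f (n + 1) ≫ T.right.hom = S.right.hom ≫ c

/-- Homotopy equivalence of complexes with fixed ends `A`, `C`: there are mutually inverse (up to
homotopy of complexes) morphisms of the form `(id_A, f₁, …, fₙ, id_C)`. -/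
def HtpyEquiv (S T : NSeq n A C) : Prop :=
  ∃ (f : S.X ⟶ T.X) (g : T.X ⟶ S.X),
    IsLift (S := S) (T := T) f (𝟙 A) (𝟙 C) ∧ IsLift (S := T) (T := S) g (𝟙 A) (𝟙 C) ∧
    Nonempty (Homotopy (f ≫ g) (𝟙 S.X)) ∧ Nonempty (Homotopy (g ≫ f) (𝟙 T.X))

/-- `M`, with projections `pᵢ : Mᵢ → Xᵢ₊₁` and `qᵢ : Mᵢ → Yᵢ`, is the mapping cone
`X₁ → X₂ ⊕ Y₁ → ⋯ → Xₙ₊₁ ⊕ Yₙ → Yₙ₊₁` of a morphism `f : X → Y` with `f₀ = id_A`, with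
differentials `[-d, 0; f, d]`. -/
def IsCone {D : 𝒟} {S : NSeq n A C} {T : NSeq n A D} (f : S.X ⟶ T.X)
    (M : NSeq n (S.X.X 1) D) : Prop :=
  ∃ (p : ∀ i, M.X.X i ⟶ S.X.X (i + 1)) (q : ∀ i, M.X.X i ⟶ T.X.X i),
    p 0 = M.left.hom ∧ q 0 = 0 ∧
    (∀ i, 1 ≤ i → i ≤ n → Nonempty (IsLimit (BinaryFan.mk (p i) (q i)))) ∧
    q (n + 1) ≫ T.right.hom = M.right.hom ∧
    (∀ i, i < n → M.X.d i (i + 1) ≫ p (i + 1) = -(p i ≫ S.X.d (i + 1) (i + 2))) ∧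
    (∀ i, i ≤ n → M.X.d i (i + 1) ≫ q (i + 1) = p i ≫ f.f (i + 1) + q i ≫ T.X.d i (i + 1))

/-- `N`, with inclusions `kᵢ : Xᵢ → Nᵢ` and `lᵢ : Yᵢ → Nᵢ₊₁`, is the mapping cocone
`X₀ → X₁ ⊕ Y₀ → ⋯ → Xₙ ⊕ Yₙ₋₁ → Yₙ` of a morphism `f : X → Y` with `fₙ₊₁ = id_C`; this is the
mapping cone of the opposite morphism in the opposite category, so the differentials are
`[d, 0; f, -d]`. -/
def IsCocone {B : 𝒟} {S : NSeq n A C} {T : NSeq n B C} (f : S.X ⟶ T.X)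
    (N : NSeq n A (T.X.X n)) : Prop :=
  ∃ (k : ∀ i, S.X.X i ⟶ N.X.X i) (l : ∀ i, T.X.X i ⟶ N.X.X (i + 1)),
    k 0 ≫ N.left.hom = S.left.hom ∧ k (n + 1) = 0 ∧
    (∀ i, i < n → Nonempty (IsColimit (BinaryCofan.mk (k (i + 1)) (l i)))) ∧
    l n ≫ N.right.hom = 𝟙 (T.X.X n) ∧
    (∀ i, i < n → l i ≫ N.X.d (i + 1) (i + 2) = -(T.X.d i (i + 1) ≫ l (i + 1))) ∧
    (∀ i, i ≤ n → k i ≫ N.X.d i (i + 1) = S.X.d i (i + 1) ≫ k (i + 1) + f.f i ≫ l i)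

end NSeq

/-- `X₀ → X₁ → ⋯ → Xₙ₊₁` is a weak kernel-cokernel sequence: for every object `P` the sequences
`Hom(P, X₀) → ⋯ → Hom(P, Xₙ₊₁)` and `Hom(Xₙ₊₁, P) → ⋯ → Hom(X₀, P)` are exact. -/
structure IsWeakKerCoker (n : ℕ) (X : CochainComplex 𝒟 ℕ) : Prop where
  cov : ∀ (P : 𝒟) (i : ℕ), i < n →
    Function.Exact (fun g : P ⟶ X.X i => g ≫ X.d i (i + 1))
      (fun g : P ⟶ X.X (i + 1) => g ≫ X.d (i + 1) (i + 2))
  contra : ∀ (P : 𝒟) (i : ℕ), i < n →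
    Function.Exact (fun g : X.X (i + 2) ⟶ P => X.d (i + 1) (i + 2) ≫ g)
      (fun g : X.X (i + 1) ⟶ P => X.d i (i + 1) ≫ g)

/-- `⟨X, δ⟩` is an `n`-exangle: for every object `P` the sequences
`Hom(P, A) → Hom(P, X₁) → ⋯ → Hom(P, Xₙ) → Hom(P, C) → E(P, A)` and
`Hom(C, P) → Hom(Xₙ, P) → ⋯ → Hom(X₁, P) → Hom(A, P) → E(C, P)` are exact (exactness at
`X₁, …, Xₙ` is `IsWeakKerCoker`, as `X₀` is identified with `A` and `Xₙ₊₁` with `C`). -/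
structure IsNExangle (E : 𝒟ᵒᵖ ⥤ 𝒟 ⥤ AddCommGrpCat.{w}) {n : ℕ} {A C : 𝒟} (S : NSeq n A C)
    (δ : Ext E C A) : Prop where
  isWeakKerCoker : IsWeakKerCoker n S.X
  cov_last : ∀ P : 𝒟,
    Function.Exact (fun g : P ⟶ S.X.X n => g ≫ S.last) (fun g : P ⟶ C => pull E g δ)
  contra_last : ∀ P : 𝒟,
    Function.Exact (fun g : S.X.X 1 ⟶ P => S.first ≫ g) (fun g : A ⟶ P => push E g δ)

/-- A realization `𝔰` of `E`: to every extension it associates a homotopy equivalence class of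
complexes with the same ends, and every morphism of extensions lifts. -/
structure Realization (n : ℕ) (E : 𝒟ᵒᵖ ⥤ 𝒟 ⥤ AddCommGrpCat.{w}) where
  /-- the homotopy equivalence class `𝔰(δ)` -/
  cls : ∀ {C A : 𝒟}, Ext E C A → Set (NSeq n A C)
  nonempty : ∀ {C A : 𝒟} (δ : Ext E C A), (cls δ).Nonempty
  mem_iff : ∀ {C A : 𝒟} (δ : Ext E C A) (S T : NSeq n A C), S ∈ cls δ →
    (T ∈ cls δ ↔ S.HtpyEquiv T)
  exists_lift : ∀ {C A C' A' : 𝒟} (δ : Ext E C A) (ρ : Ext E C' A') (S : NSeq n A C)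
    (T : NSeq n A' C'), S ∈ cls δ → T ∈ cls ρ → ∀ (a : A ⟶ A') (c : C ⟶ C'),
    push E a δ = pull E c ρ → ∃ f : S.X ⟶ T.X, NSeq.IsLift (S := S) (T := T) f a c

namespace Realization

variable {n : ℕ} {E : 𝒟ᵒᵖ ⥤ 𝒟 ⥤ AddCommGrpCat.{w}} (𝔰 : Realization n E)

/-- `f : A → B` is an inflation: it is the first map of a conflation. -/
def IsInflation {A B : 𝒟} (f : A ⟶ B) : Prop :=
  ∃ (C : 𝒟) (δ : Ext E C A) (S : NSeq n A C) (_ : S ∈ 𝔰.cls δ) (e : S.X.X 1 ≅ B),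
    S.first ≫ e.hom = f

/-- `g : B → C` is a deflation: it is the last map of a conflation. -/
def IsDeflation {B C : 𝒟} (g : B ⟶ C) : Prop :=
  ∃ (A : 𝒟) (δ : Ext E C A) (S : NSeq n A C) (_ : S ∈ 𝔰.cls δ) (e : B ≅ S.X.X n),
    e.hom ≫ S.last = g

/-- The axioms of a weakly `n`-exangulated category. -/
structure IsWeaklyNExangulated : Prop where
  /-- (C1) -/
  exangle : ∀ {C A : 𝒟} (δ : Ext E C A) (S : NSeq n A C), S ∈ 𝔰.cls δ → IsNExangle E S δ
  /-- (C2): `𝔰(0) = [A = A → 0 → ⋯ → 0]` for `0 ∈ E(0, A)` -/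
  id_zero : ∀ {A Z : 𝒟}, IsZero Z → ∀ S : NSeq n A Z, IsIso (S.X.d 0 1) →
    (∀ i, 2 ≤ i → IsZero (S.X.X i)) → S ∈ 𝔰.cls (0 : Ext E Z A)
  /-- (C2'): `𝔰(0) = [0 → ⋯ → 0 → A = A]` for `0 ∈ E(A, 0)` -/
  zero_id : ∀ {A Z : 𝒟}, IsZero Z → ∀ S : NSeq n Z A, IsIso (S.X.d n (n + 1)) →
    (∀ i, i < n → IsZero (S.X.X i)) → S ∈ 𝔰.cls (0 : Ext E A Z)
  /-- (C3): `(a, id_C) : δ → a_* δ` has a good lift -/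
  cocone : ∀ {C A B : 𝒟} (δ : Ext E C A) (a : A ⟶ B) (S : NSeq n A C) (T : NSeq n B C),
    S ∈ 𝔰.cls δ → T ∈ 𝔰.cls (push E a δ) →
    ∃ f : S.X ⟶ T.X, NSeq.IsLift (S := S) (T := T) f a (𝟙 C) ∧
      ∃ N ∈ 𝔰.cls (pull E T.last δ), NSeq.IsCocone (S := S) (T := T) f N
  /-- (C3'): `(id_A, c) : c^* ρ → ρ` has a good lift -/
  cone : ∀ {C D A : 𝒟} (ρ : Ext E D A) (c : C ⟶ D) (S : NSeq n A C) (T : NSeq n A D),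
    S ∈ 𝔰.cls (pull E c ρ) → T ∈ 𝔰.cls ρ →
    ∃ f : S.X ⟶ T.X, NSeq.IsLift (S := S) (T := T) f (𝟙 A) c ∧
      ∃ M ∈ 𝔰.cls (push E S.first ρ), NSeq.IsCone (S := S) (T := T) f M

/-- The axioms of an `n`-exangulated category. -/
structure IsNExangulated : Prop extends 𝔰.IsWeaklyNExangulated where
  /-- (C4) -/
  inflation_comp : ∀ {A B C : 𝒟} (f : A ⟶ B) (g : B ⟶ C), 𝔰.IsInflation f → 𝔰.IsInflation g →
    𝔰.IsInflation (f ≫ g)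
  deflation_comp : ∀ {A B C : 𝒟} (f : A ⟶ B) (g : B ⟶ C), 𝔰.IsDeflation f → 𝔰.IsDeflation g →
    𝔰.IsDeflation (f ≫ g)

end Realization

end Sequences

section IdealQuotient

variable {𝒞 : Type u} [Category.{v} 𝒞] [Preadditive 𝒞] [HasZeroObject 𝒞] [HasBinaryBiproducts 𝒞]

open ZeroObject

/-- Condition (M0): `F` contains all isomorphisms and is closed under composition and finite
direct sums. -/
class M0 (F : MorphismProperty 𝒞) : Prop where
  of_isIso : ∀ {X Y : 𝒞} (f : X ⟶ Y), IsIso f → F f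
  comp : ∀ {X Y Z : 𝒞} (f : X ⟶ Y) (g : Y ⟶ Z), F f → F g → F (f ≫ g)
  biprod : ∀ {X Y X' Y' : 𝒞} (f : X ⟶ Y) (f' : X' ⟶ Y'), F f → F f' → F (biprod.map f f')

/-- The objects of `N_F`: `N → 0` and `0 → N` belong to `F`. -/
def IsNull (F : MorphismProperty 𝒞) (N : 𝒞) : Prop :=
  F (0 : N ⟶ (0 : 𝒞)) ∧ F (0 : (0 : 𝒞) ⟶ N)

/-- Congruence modulo the ideal `[N_F]` of morphisms factoring through an object of `N_F`. -/
def idealRel (F : MorphismProperty 𝒞) : HomRel 𝒞 := fun X Y f g =>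
  ∃ (N : 𝒞) (_ : IsNull F N) (i : X ⟶ N) (j : N ⟶ Y), f - g = i ≫ j

/-- The ideal quotient `𝒞̄ = 𝒞 / [N_F]`. -/
abbrev CBar (F : MorphismProperty 𝒞) : Type u := CategoryTheory.Quotient (idealRel F)

/-- The projection `p : 𝒞 → 𝒞̄`. -/
abbrev p (F : MorphismProperty 𝒞) : 𝒞 ⥤ CBar F := CategoryTheory.Quotient.functor (idealRel F)

/-- `F̄`: the morphisms of `𝒞̄` of the form `β ∘ p(f) ∘ α` with `f ∈ F` and isomorphisms `α, β`. -/
abbrev FBar (F : MorphismProperty 𝒞) : MorphismProperty (CBar F) := F.map (p F)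

variable (F : MorphismProperty 𝒞)

section
variable {F}

lemma isNull_zero [M0 F] : IsNull F (0 : 𝒞) :=
  ⟨M0.of_isIso _ ⟨0, by ext, by ext⟩, M0.of_isIso _ ⟨0, by ext, by ext⟩⟩

lemma isNull_biprod [M0 F] {N N' : 𝒞} (h : IsNull F N) (h' : IsNull F N') :
    IsNull F (N ⊞ N') := by
  have hz : IsZero ((0 : 𝒞) ⊞ (0 : 𝒞)) := by
    rw [IsZero.iff_id_eq_zero]
    ext
  have h1 : IsIso (0 : (0 : 𝒞) ⊞ (0 : 𝒞) ⟶ (0 : 𝒞)) :=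
    ⟨0, hz.eq_of_src _ _, by ext⟩
  have h2 : IsIso (0 : (0 : 𝒞) ⟶ (0 : 𝒞) ⊞ (0 : 𝒞)) :=
    ⟨0, by ext, hz.eq_of_src _ _⟩
  constructor
  · have := M0.comp _ _ (M0.biprod _ _ h.1 h'.1) (M0.of_isIso _ h1)
    rwa [comp_zero] at this
  · have := M0.comp _ _ (M0.of_isIso _ h2) (M0.biprod _ _ h.2 h'.2)
    rwa [zero_comp] at this

end

instance [M0 F] : Congruence (idealRel F) where
  comp_left f g g' := by
    rintro ⟨N, hN, i, j, h⟩
    exact ⟨N, hN, f ≫ i, j, by rw [← Preadditive.comp_sub, h, Category.assoc]⟩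
  comp_right g := by
    rintro ⟨N, hN, i, j, h⟩
    exact ⟨N, hN, i, j ≫ g, by rw [← Preadditive.sub_comp, h, Category.assoc]⟩
  equivalence :=
    { refl f := ⟨0, isNull_zero, 0, 0, by simp⟩
      symm := by
        rintro f g ⟨N, hN, i, j, h⟩
        exact ⟨N, hN, -i, j, by rw [Preadditive.neg_comp, ← h, neg_sub]⟩
      trans := by
        rintro f g k ⟨N, hN, i, j, h⟩ ⟨N', hN', i', j', h'⟩
        exact ⟨N ⊞ N', isNull_biprod hN hN', biprod.lift i i', biprod.desc j j', by
          rw [biprod.lift_desc, ← h, ← h', sub_add_sub_cancel]⟩ }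

lemma idealRel_add [M0 F] ⦃X Y : 𝒞⦄ (f₁ f₂ g₁ g₂ : X ⟶ Y) (h : idealRel F f₁ f₂)
    (h' : idealRel F g₁ g₂) : idealRel F (f₁ + g₁) (f₂ + g₂) := by
  obtain ⟨N, hN, i, j, h⟩ := h
  obtain ⟨N', hN', i', j', h'⟩ := h'
  exact ⟨N ⊞ N', isNull_biprod hN hN', biprod.lift i i', biprod.desc j j', by
    rw [biprod.lift_desc, ← h, ← h', add_sub_add_comm]⟩

instance [M0 F] : Preadditive (CBar F) := CategoryTheory.Quotient.preadditive _ (idealRel_add F)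

instance [M0 F] : (p F).Additive := CategoryTheory.Quotient.functor_additive _ (idealRel_add F)

/-- `𝒞̃`, the localization of `𝒞̄` by `F̄`. -/
abbrev CTilde : Type u := (FBar F).Localization

/-- The localization functor `Q : 𝒞 → 𝒞̃`. -/
noncomputable abbrev Q : 𝒞 ⥤ CTilde F := p F ⋙ (FBar F).Q

variable {F}

lemma FBar.map_p {X Y : 𝒞} {f : X ⟶ Y} (hf : F f) : FBar F ((p F).map f) :=
  MorphismProperty.map_mem_map _ _ _ hf

/-- `Q(f)` is invertible for `f ∈ F`. -/
noncomputable def isoOfMem {X Y : 𝒞} (f : X ⟶ Y) (hf : F f) : (Q F).obj X ≅ (Q F).obj Y :=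
  Localization.Construction.wIso ((p F).map f) (FBar.map_p hf)

end IdealQuotient

section Localization

variable {𝒞 : Type u} [Category.{v} 𝒞] [Preadditive 𝒞] [HasZeroObject 𝒞] [HasBinaryBiproducts 𝒞]
  {n : ℕ} {E : 𝒞ᵒᵖ ⥤ 𝒞 ⥤ AddCommGrpCat.{w}}

open ZeroObject

/-- Condition (MR3): morphisms of extensions with ends in `F̄` lift to `𝒞̄` with all components
in `F̄`. -/
def MR3 (𝔰 : Realization n E) (F : MorphismProperty 𝒞) : Prop :=
  ∀ {C A C' A' : 𝒞} (δ : Ext E C A) (δ' : Ext E C' A') (S : NSeq n A C) (T : NSeq n A' C'),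
    S ∈ 𝔰.cls δ → T ∈ 𝔰.cls δ' → ∀ (a : A ⟶ A') (c : C ⟶ C'), push E a δ = pull E c δ' →
    FBar F ((p F).map a) → FBar F ((p F).map c) →
    ∃ b : ∀ i, (p F).obj (S.X.X i) ⟶ (p F).obj (T.X.X i),
      (∀ i, 1 ≤ i → i ≤ n → FBar F (b i)) ∧
      b 0 ≫ (p F).map T.left.hom = (p F).map (S.left.hom ≫ a) ∧
      b (n + 1) ≫ (p F).map T.right.hom = (p F).map (S.right.hom ≫ c) ∧
      ∀ i, i ≤ n → b i ≫ (p F).map (T.X.d i (i + 1)) = (p F).map (S.X.d i (i + 1)) ≫ b (i + 1)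

/-- The standing assumptions: `(𝒞, E, 𝔰)` is `n`-exangulated with `n` positive, `F = p⁻¹(F̄)`, and
(MR3) holds. (The conditions (M0), (MR1), (MR2) are the type classes `M0 F`,
`(FBar F).HasTwoOutOfThreeProperty`, `(FBar F).HasLeftCalculusOfFractions` and
`(FBar F).HasRightCalculusOfFractions`.) -/
structure LocAssumptions (𝔰 : Realization n E) (F : MorphismProperty 𝒞) : Prop where
  pos : 1 ≤ n
  exangulated : 𝔰.IsNExangulated
  saturated : F = (FBar F).inverseImage (p F)
  mr3 : MR3 𝔰 F

lemma push_sub [∀ C, (E.obj C).Additive] {C A A' : 𝒞} (a b : A ⟶ A') (δ : Ext E C A) :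
    push E (a - b) δ = push E a δ - push E b δ := by
  simp only [push, Functor.map_sub]
  rfl

lemma pull_sub [E.Additive] {C C' A : 𝒞} (a b : C' ⟶ C) (δ : Ext E C A) :
    pull E (a - b) δ = pull E a δ - pull E b δ := by
  simp only [pull, op_sub, Functor.map_sub]
  rfl

lemma push_zero [∀ C, (E.obj C).Additive] {C A A' : 𝒞} (δ : Ext E C A) :
    push E (0 : A ⟶ A') δ = 0 := by
  have := push_sub (E := E) (0 : A ⟶ A') 0 δ
  rwa [sub_self, sub_self] at this

lemma pull_zero [E.Additive] {C C' A : 𝒞} (δ : Ext E C A) :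
    pull E (0 : C' ⟶ C) δ = 0 := by
  have := pull_sub (E := E) (0 : C' ⟶ C) 0 δ
  rwa [sub_self, sub_self] at this

variable {𝔰 : Realization n E} {F : MorphismProperty 𝒞}

namespace LocAssumptions

variable [M0 F] [(FBar F).HasTwoOutOfThreeProperty] [(FBar F).HasLeftCalculusOfFractions]
  [(FBar F).HasRightCalculusOfFractions]

lemma mem_iff (h : LocAssumptions 𝔰 F) {X Y : 𝒞} (f : X ⟶ Y) : F f ↔ FBar F ((p F).map f) :=
  ⟨FBar.map_p, fun hf => by rw [h.saturated]; exact hf⟩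

lemma exists_pull_of_push (h : LocAssumptions 𝔰 F) {C A B : 𝒞} (δ : Ext E C A) (s : A ⟶ B)
    (hs : F s) (e : push E s δ = 0) : ∃ (B' : 𝒞) (t : B' ⟶ C), F t ∧ pull E t δ = 0 := by
  obtain ⟨S, hS⟩ := 𝔰.nonempty δ
  obtain ⟨T, hT⟩ := 𝔰.nonempty (push E s δ)
  obtain ⟨b, hb, -, hr, hd⟩ := h.mr3 δ (push E s δ) S T hS hT s (𝟙 C) (pull_id E _).symm
    (FBar.map_p hs) (FBar.map_p (M0.of_isIso _ inferInstance))
  have hbn := hb n h.pos le_rfl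
  have hl : b n ≫ (p F).map T.last = (p F).map S.last := by
    rw [NSeq.last, NSeq.last, Functor.map_comp, ← Category.assoc, hd n le_rfl, Category.assoc, hr,
      Category.comp_id, Functor.map_comp]
  obtain ⟨m, hm⟩ := ((h.exangulated.exangle _ T hT).cov_last C (𝟙 C)).1 (by
    change pull E (𝟙 C) (push E s δ) = 0
    rw [e, map_zero])
  obtain ⟨⟨Z⟩, k, hk, g, hg⟩ := ore_right (b n) hbn ((p F).map m)
  obtain ⟨g, rfl⟩ := (p F).map_surjective (X := Z) g
  refine ⟨Z, g ≫ S.last, (h.mem_iff _).2 ?_, ?_⟩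
  · have : (p F).map (g ≫ S.last) = k := by
      rw [Functor.map_comp, ← hl, ← Category.assoc, hg, Category.assoc, ← Functor.map_comp]
      change k ≫ (p F).map (m ≫ T.last) = k
      rw [show m ≫ T.last = 𝟙 C from hm, CategoryTheory.Functor.map_id, Category.comp_id]
    rwa [this]
  · exact ((h.exangulated.exangle δ S hS).cov_last Z (g ≫ S.last)).2 ⟨g, rfl⟩

lemma exists_push_of_pull (h : LocAssumptions 𝔰 F) {C A B : 𝒞} (δ : Ext E C A) (t : B ⟶ C)
    (ht : F t) (e : pull E t δ = 0) : ∃ (B' : 𝒞) (s : A ⟶ B'), F s ∧ push E s δ = 0 := by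
  obtain ⟨T, hT⟩ := 𝔰.nonempty δ
  obtain ⟨S, hS⟩ := 𝔰.nonempty (pull E t δ)
  obtain ⟨b, hb, hl, -, hd⟩ := h.mr3 (pull E t δ) δ S T hS hT (𝟙 A) t (push_id E _)
    (FBar.map_p (M0.of_isIso _ inferInstance)) (FBar.map_p ht)
  have hb1 := hb 1 le_rfl h.pos
  have hl' : (p F).map S.first ≫ b 1 = (p F).map T.first := by
    have hl2 : (p F).map S.left.inv ≫ b 0 = (p F).map T.left.inv := by
      rw [← cancel_mono ((p F).map T.left.hom), Category.assoc, hl, ← Functor.map_comp,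
        ← Functor.map_comp, Category.comp_id, Iso.inv_hom_id, Iso.inv_hom_id]
    rw [NSeq.first, NSeq.first, Functor.map_comp, Category.assoc]
    exact (congrArg _ (hd 0 (Nat.zero_le _)).symm).trans
      (by rw [← Category.assoc, hl2, ← Functor.map_comp])
  obtain ⟨m, hm⟩ := ((h.exangulated.exangle _ S hS).contra_last A (𝟙 A)).1 (by
    change push E (𝟙 A) (pull E t δ) = 0
    rw [e, map_zero])
  obtain ⟨⟨Z⟩, k, hk, g, hg⟩ := ore_left (b 1) hb1 ((p F).map m)
  obtain ⟨g, rfl⟩ := (p F).map_surjective (Y := Z) g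
  refine ⟨Z, T.first ≫ g, (h.mem_iff _).2 ?_, ?_⟩
  · have : (p F).map (T.first ≫ g) = k := by
      rw [Functor.map_comp, ← hl', Category.assoc, hg, ← Category.assoc, ← Functor.map_comp]
      change (p F).map (S.first ≫ m) ≫ k = k
      rw [show S.first ≫ m = 𝟙 A from hm, CategoryTheory.Functor.map_id, Category.id_comp]
    rwa [this]
  · exact ((h.exangulated.exangle δ T hT).contra_last Z (T.first ≫ g)).2 ⟨g, rfl⟩

/-- `K(C, A) = {δ ∈ E(C, A) | s_* δ = 0 for some s ∈ F}`. -/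
def K (h : LocAssumptions 𝔰 F) (C A : 𝒞) : AddSubgroup (Ext E C A) where
  carrier := {δ | ∃ (B : 𝒞) (s : A ⟶ B), F s ∧ push E s δ = 0}
  zero_mem' := ⟨A, 𝟙 A, M0.of_isIso _ inferInstance, map_zero _⟩
  neg_mem' := by
    rintro δ ⟨B, s, hs, e⟩
    exact ⟨B, s, hs, by rw [map_neg, e, neg_zero]⟩
  add_mem' := by
    rintro δ ε ⟨B, s, hs, e⟩ hε
    obtain ⟨B', t, ht, e'⟩ : ∃ (B' : 𝒞) (t : B' ⟶ C), F t ∧ pull E t ε = 0 := by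
      obtain ⟨B', s', hs', e'⟩ := hε
      exact h.exists_pull_of_push ε s' hs' e'
    obtain ⟨B'', r, hr, e''⟩ := h.exists_push_of_pull (push E s ε) t ht
      (by rw [pull_push, e', map_zero])
    exact ⟨B'', s ≫ r, M0.comp _ _ hs hr, by
      rw [push_comp, map_add, e, zero_add, e'']⟩

lemma mem_K (h : LocAssumptions 𝔰 F) {C A : 𝒞} (δ : Ext E C A) :
    δ ∈ h.K C A ↔ ∃ (B : 𝒞) (s : A ⟶ B), F s ∧ push E s δ = 0 := Iff.rfl

lemma mem_K' (h : LocAssumptions 𝔰 F) {C A : 𝒞} (δ : Ext E C A) :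
    δ ∈ h.K C A ↔ ∃ (B : 𝒞) (t : B ⟶ C), F t ∧ pull E t δ = 0 :=
  ⟨fun ⟨_, s, hs, e⟩ => h.exists_pull_of_push δ s hs e,
    fun ⟨_, t, ht, e⟩ => h.exists_push_of_pull δ t ht e⟩

lemma push_mem_K (h : LocAssumptions 𝔰 F) {C A A' : 𝒞} (a : A ⟶ A') (δ : Ext E C A)
    (hδ : δ ∈ h.K C A) : push E a δ ∈ h.K C A' := by
  obtain ⟨B, t, ht, e⟩ := (h.mem_K' δ).1 hδ
  exact (h.mem_K' _).2 ⟨B, t, ht, by rw [pull_push, e, map_zero]⟩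

lemma pull_mem_K (h : LocAssumptions 𝔰 F) {C C' A : 𝒞} (c : C' ⟶ C) (δ : Ext E C A)
    (hδ : δ ∈ h.K C A) : pull E c δ ∈ h.K C' A := by
  obtain ⟨B, s, hs, e⟩ := hδ
  exact ⟨B, s, hs, by rw [← pull_push, e, map_zero]⟩

/-- The bifunctor `E/K : 𝒞ᵒᵖ × 𝒞 → Ab`. -/
def EK (h : LocAssumptions 𝔰 F) : 𝒞ᵒᵖ ⥤ 𝒞 ⥤ AddCommGrpCat.{w} where
  obj C :=
    { obj := fun A => AddCommGrpCat.of (Ext E C.unop A ⧸ h.K C.unop A)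
      map := fun {A A'} a => AddCommGrpCat.ofHom
        (QuotientAddGroup.map (h.K C.unop A) (h.K C.unop A') (push E a) (h.push_mem_K a))
      map_id := fun A => by
        ext x
        exact congrArg QuotientAddGroup.mk (push_id E x)
      map_comp := fun a a' => by
        ext x
        exact congrArg QuotientAddGroup.mk (push_comp E a a' x) }
  map {C C'} c :=
    { app := fun A => AddCommGrpCat.ofHom
        (QuotientAddGroup.map (h.K C.unop A) (h.K C'.unop A) (pull E c.unop)
          (h.pull_mem_K c.unop))
      naturality := fun A A' a => by
        ext x
        exact congrArg QuotientAddGroup.mk (pull_push E c.unop a x) }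
  map_id C := by
    ext A x
    exact congrArg QuotientAddGroup.mk (pull_id E x)
  map_comp c c' := by
    ext A x
    exact congrArg QuotientAddGroup.mk (pull_comp E c.unop c'.unop x)

variable [E.Additive] [∀ C, (E.obj C).Additive]

lemma EK_push_eq (h : LocAssumptions 𝔰 F) {C A A' : 𝒞} (a a' : A ⟶ A') (haa' : idealRel F a a')
    (δ : Ext E C A) : push E a δ - push E a' δ ∈ h.K C A' := by
  obtain ⟨N, hN, i, j, e⟩ := haa'
  rw [← push_sub, e, push_comp]
  refine h.push_mem_K j _ ⟨0, 0, hN.1, ?_⟩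
  exact push_zero _

lemma EK_pull_eq (h : LocAssumptions 𝔰 F) {C C' A : 𝒞} (c c' : C' ⟶ C) (hcc' : idealRel F c c')
    (δ : Ext E C A) : pull E c δ - pull E c' δ ∈ h.K C' A := by
  obtain ⟨N, hN, i, j, e⟩ := hcc'
  rw [← pull_sub, e, pull_comp]
  refine h.pull_mem_K i _ ((h.mem_K' _).2 ⟨0, 0, hN.2, ?_⟩)
  exact pull_zero _

/-- `E/K` as a functor `𝒞ᵒᵖ × 𝒞̄ → Ab`. -/
def EK₁ (h : LocAssumptions 𝔰 F) : 𝒞ᵒᵖ ⥤ CBar F ⥤ AddCommGrpCat.{w} :=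
  (CategoryTheory.Quotient.lift (idealRel F) h.EK.flip (fun A A' a a' haa' => by
    ext C x
    obtain ⟨δ, rfl⟩ := QuotientAddGroup.mk_surjective x
    exact (QuotientAddGroup.eq_iff_sub_mem).2 (h.EK_push_eq a a' haa' δ))).flip

/-- The bifunctor `Ē : 𝒞̄ᵒᵖ × 𝒞̄ → Ab`. -/
def EBar (h : LocAssumptions 𝔰 F) : (CBar F)ᵒᵖ ⥤ CBar F ⥤ AddCommGrpCat.{w} :=
  (CategoryTheory.Quotient.lift (idealRel F) h.EK₁.rightOp (fun C' C c c' hcc' => by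
    apply Quiver.Hom.unop_inj
    ext ⟨A⟩ x
    obtain ⟨δ, rfl⟩ := QuotientAddGroup.mk_surjective x
    exact (QuotientAddGroup.eq_iff_sub_mem).2 (h.EK_pull_eq c c' hcc' δ))).leftOp

/-- `δ ↦ δ̄`, the projection `E(C, A) → Ē(C, A) = E(C, A) / K(C, A)`. -/
def bar (h : LocAssumptions 𝔰 F) {C A : 𝒞} :
    Ext E C A →+ Ext h.EBar ((p F).obj C) ((p F).obj A) :=
  QuotientAddGroup.mk' (h.K C A)

lemma bar_surjective (h : LocAssumptions 𝔰 F) {C A : 𝒞} :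
    Function.Surjective (h.bar (C := C) (A := A)) := QuotientAddGroup.mk'_surjective _

lemma bar_eq_zero_iff (h : LocAssumptions 𝔰 F) {C A : 𝒞} (δ : Ext E C A) :
    h.bar δ = 0 ↔ δ ∈ h.K C A := QuotientAddGroup.eq_zero_iff δ

lemma push_bar (h : LocAssumptions 𝔰 F) {C A A' : 𝒞} (a : A ⟶ A') (δ : Ext E C A) :
    push h.EBar ((p F).map a) (h.bar δ) = h.bar (push E a δ) := rfl

lemma pull_bar (h : LocAssumptions 𝔰 F) {C C' A : 𝒞} (c : C' ⟶ C) (δ : Ext E C A) :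
    pull h.EBar ((p F).map c) (h.bar δ) = h.bar (pull E c δ) := rfl

/-- The bifunctor `Ẽ : 𝒞̃ᵒᵖ × 𝒞̃ → Ab`. -/
noncomputable def ETilde (h : LocAssumptions 𝔰 F) :
    (CTilde F)ᵒᵖ ⥤ CTilde F ⥤ AddCommGrpCat.{max u v w} :=
  TExt.functor (FBar F) h.EBar

/-- The `Ẽ`-extension `[t̄ \ δ̄ / s̄] = [C ⟸ Z ⇢ X ⟸ A] ∈ Ẽ(C, A)`. -/
noncomputable def frac (h : LocAssumptions 𝔰 F) {A C X Z : 𝒞} (t : Z ⟶ C) (ht : F t)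
    (δ : Ext E Z X) (s : A ⟶ X) (hs : F s) : Ext h.ETilde ((Q F).obj C) ((Q F).obj A) :=
  TExt.toExt (FBar F) h.EBar (TExt.mk h.EBar
    ⟨(p F).obj Z, (p F).obj X, (p F).map t, FBar.map_p ht, (p F).map s, FBar.map_p hs⟩ (h.bar δ))

end LocAssumptions

/-- For a complex `X → X₁ → ⋯ → Xₙ → Z` with maps `x₀, …, xₙ`, and `s : A → X`, `t : Z → C` in
`F`, the complex `A → X₁ → ⋯ → Xₙ → C` in `𝒞̃` with maps
`Q(x₀ ∘ s), Q(x₁), …, Q(xₙ₋₁), Q(t ∘ xₙ)`, realizing `[t̄ \ δ̄ / s̄]` if the given one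
realizes `δ`. -/
noncomputable def locSeq [M0 F] [(FBar F).HasLeftCalculusOfFractions] {A C X Z : 𝒞}
    (t : Z ⟶ C) (ht : F t) (S : NSeq n X Z) (s : A ⟶ X) (hs : F s) :
    NSeq n ((Q F).obj A) ((Q F).obj C) where
  X := ((Q F).mapHomologicalComplex _).obj S.X
  isZero i hi := (Q F).map_isZero (S.isZero i hi)
  left := (Q F).mapIso S.left ≪≫ (isoOfMem s hs).symm
  right := (Q F).mapIso S.right ≪≫ isoOfMem t ht

lemma locSeq_first [M0 F] [(FBar F).HasLeftCalculusOfFractions] {A C X Z : 𝒞}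
    (t : Z ⟶ C) (ht : F t) (S : NSeq n X Z) (s : A ⟶ X) (hs : F s) :
    (locSeq t ht S s hs).first = (Q F).map (s ≫ S.first) := by
  change ((Q F).map s ≫ (Q F).map S.left.inv) ≫ (Q F).map _ = _
  rw [← Functor.map_comp, ← Functor.map_comp, Category.assoc]; rfl

lemma locSeq_last [M0 F] [(FBar F).HasLeftCalculusOfFractions] {A C X Z : 𝒞}
    (t : Z ⟶ C) (ht : F t) (S : NSeq n X Z) (s : A ⟶ X) (hs : F s) :
    (locSeq t ht S s hs).last = (Q F).map (S.last ≫ t) := by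
  change (Q F).map _ ≫ (Q F).map S.right.hom ≫ (Q F).map t = _
  rw [← Functor.map_comp, ← Functor.map_comp, ← Category.assoc]; rfl

end Localization
end NExLoc

/-! A fraction `[t̄ \ δ̄ / s̄]` vanishes in `Ẽ` exactly when `δ` lies in `K`, because `K` contains
`δ` as soon as it contains `v^* u_* δ` for some `u, v ∈ F`. Every morphism `γ` of `𝒞̃` into `C`
can be written as a roof `Q(v) ≫ γ = Q(c ≫ t)` with `v ∈ F` and `c` a morphism of `𝒞` into `Z`,
since `Q(t)` is invertible, and then `γ^* [t̄ \ δ̄ / s̄] = [v̄ \ (c^* δ)‾ / s̄]`. So `γ` is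
annihilated iff `w^* c^* δ = 0` for some `w ∈ F`, which by the exactness axiom of `n`-exangles in
`𝒞` means that `w ≫ c` factors through `xₙ`; inverting `Q(w ≫ v)` gives the required
factorization of `γ` through `Q(t ∘ xₙ)`. The contravariant statement is dual, and exactness at
`X₁, …, Xₙ` is the hypothesis that `Q(X)` is a weak kernel-cokernel sequence. -/

namespace NExLoc
namespace LocAssumptions

variable {𝒞 : Type u} [Category.{v} 𝒞] [Preadditive 𝒞] [HasZeroObject 𝒞] [HasBinaryBiproducts 𝒞]
  {n : ℕ} {E : 𝒞ᵒᵖ ⥤ 𝒞 ⥤ AddCommGrpCat.{w}} {𝔰 : Realization n E} {F : MorphismProperty 𝒞}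
  [M0 F] [(FBar F).HasTwoOutOfThreeProperty] [(FBar F).HasLeftCalculusOfFractions]
  [(FBar F).HasRightCalculusOfFractions]

lemma mem_K_of_push_mem_K (h : LocAssumptions 𝔰 F) {C A A' : 𝒞} (u : A ⟶ A') (hu : F u)
    (δ : Ext E C A) (hδ : push E u δ ∈ h.K C A') : δ ∈ h.K C A := by
  obtain ⟨B, s, hs, e⟩ := hδ
  exact ⟨B, u ≫ s, M0.comp _ _ hu hs, by rw [push_comp, e]⟩

lemma mem_K_of_pull_mem_K (h : LocAssumptions 𝔰 F) {C C' A : 𝒞} (v : C' ⟶ C) (hv : F v)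
    (δ : Ext E C A) (hδ : pull E v δ ∈ h.K C' A) : δ ∈ h.K C A := by
  obtain ⟨B, t, ht, e⟩ := (h.mem_K' _).1 hδ
  exact (h.mem_K' _).2 ⟨B, t ≫ v, M0.comp _ _ ht hv, by rw [pull_comp, e]⟩

/-- Every morphism of `𝒞̃` between objects coming from `𝒞` is a right fraction of morphisms of
`𝒞`, with denominator in `F`. -/
lemma exists_right_roof (h : LocAssumptions 𝔰 F) {X Y : 𝒞} (γ : (Q F).obj X ⟶ (Q F).obj Y) :
    ∃ (B : 𝒞) (v : B ⟶ X) (_ : F v) (c : B ⟶ Y), (Q F).map v ≫ γ = (Q F).map c := by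
  obtain ⟨φ, hφ⟩ := Localization.exists_rightFraction (FBar F).Q (FBar F) γ
  obtain @⟨⟨B⟩, s, hs, f⟩ := φ
  obtain ⟨v, rfl⟩ := (p F).map_surjective (X := B) s
  obtain ⟨c, rfl⟩ := (p F).map_surjective (X := B) f
  refine ⟨B, v, (h.mem_iff v).2 hs, c, ?_⟩
  rw [hφ]
  exact MorphismProperty.RightFraction.map_s_comp_map
    (MorphismProperty.RightFraction.mk ((p F).map v) hs ((p F).map c)) (FBar F).Q _

/-- Every morphism of `𝒞̃` between objects coming from `𝒞` is a left fraction of morphisms of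
`𝒞`, with denominator in `F`. -/
lemma exists_left_roof (h : LocAssumptions 𝔰 F) {X Y : 𝒞} (α : (Q F).obj X ⟶ (Q F).obj Y) :
    ∃ (B : 𝒞) (u : Y ⟶ B) (_ : F u) (a : X ⟶ B), α ≫ (Q F).map u = (Q F).map a := by
  obtain ⟨φ, hφ⟩ := Localization.exists_leftFraction (FBar F).Q (FBar F) α
  obtain @⟨⟨B⟩, f, s, hs⟩ := φ
  obtain ⟨u, rfl⟩ := (p F).map_surjective (Y := B) s
  obtain ⟨a, rfl⟩ := (p F).map_surjective (Y := B) f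
  refine ⟨B, u, (h.mem_iff u).2 hs, a, ?_⟩
  rw [hφ]
  exact MorphismProperty.LeftFraction.map_comp_map_s _ _ _

variable [E.Additive] [∀ C, (E.obj C).Additive]

lemma frac_eq_zero_iff (h : LocAssumptions 𝔰 F) {A C X Z : 𝒞} (t : Z ⟶ C) (ht : F t)
    (δ : Ext E Z X) (s : A ⟶ X) (hs : F s) : h.frac t ht δ s hs = 0 ↔ δ ∈ h.K Z X := by
  rw [← h.bar_eq_zero_iff]
  constructor
  · intro e
    have e' := (TExt.toExt (FBar F) h.EBar).injective (e.trans (map_zero _).symm)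
    rw [← TExt.mk_zero (Den.id (FBar F) _ _), TExt.mk_eq_iff] at e'
    obtain ⟨⟨⟨Z'⟩, ⟨X'⟩, _, _, _, _⟩, ⟨v, hv, u, hu, _, _⟩, g, e'⟩ := e'
    obtain ⟨v, rfl⟩ := (p F).map_surjective (X := Z') v
    obtain ⟨u, rfl⟩ := (p F).map_surjective (Y := X') u
    have e₂ : h.bar (pull E v (push E u δ)) = 0 := e'.trans (map_zero _)
    rw [h.bar_eq_zero_iff] at e₂ ⊢
    exact h.mem_K_of_push_mem_K u ((h.mem_iff u).2 hu) _
      (h.mem_K_of_pull_mem_K v ((h.mem_iff v).2 hv) _ e₂)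
  · intro e
    rw [frac, e, TExt.mk_zero]
    exact map_zero _

/-- A roof `γ = Q(c ≫ t) ∘ Q(v)⁻¹` through the denominator `t` pulls `[t̄ \ δ̄ / s̄]` back to
`[v̄ \ (c^* δ)‾ / s̄]`: no Ore square is needed. -/
lemma pull_frac_of_roof (h : LocAssumptions 𝔰 F) {A B C C' X Z : 𝒞} (t : Z ⟶ C) (ht : F t)
    (δ : Ext E Z X) (s : A ⟶ X) (hs : F s) (γ : (Q F).obj C' ⟶ (Q F).obj C)
    (v : B ⟶ C') (hv : F v) (c : B ⟶ Z) (hγ : (Q F).map v ≫ γ = (Q F).map (c ≫ t)) :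
    pull h.ETilde γ (h.frac t ht δ s hs) = h.frac v hv (pull E c δ) s hs := by
  refine (TExt.pull_frac h.EBar
    ⟨(p F).obj Z, (p F).obj X, (p F).map t, FBar.map_p ht, (p F).map s, FBar.map_p hs⟩
    (h.bar δ) γ ((p F).map v) (FBar.map_p hv) ((p F).map (c ≫ t)) hγ
    (𝟙 _) ((FBar F).id_mem _) ((p F).map c) (by simp)).trans ?_
  have key : ∀ (v' : (p F).obj B ⟶ (p F).obj C') (hv' : FBar F v'), v' = (p F).map v →
      TExt.toExt (FBar F) h.EBar (TExt.mk h.EBar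
        ⟨_, _, v', hv', (p F).map s, FBar.map_p hs⟩ (h.bar (pull E c δ))) =
      h.frac v hv (pull E c δ) s hs := by
    rintro _ _ rfl
    rfl
  exact key _ _ (Category.id_comp _)

/-- A roof `α = Q(u)⁻¹ ∘ Q(s ≫ a)` through the denominator `s` pushes `[t̄ \ δ̄ / s̄]` forward to
`[t̄ \ (a_* δ)‾ / ū]`: no Ore square is needed. -/
lemma push_frac_of_roof (h : LocAssumptions 𝔰 F) {A A' B C X Z : 𝒞} (t : Z ⟶ C) (ht : F t)
    (δ : Ext E Z X) (s : A ⟶ X) (hs : F s) (α : (Q F).obj A ⟶ (Q F).obj A')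
    (u : A' ⟶ B) (hu : F u) (a : X ⟶ B) (hα : α ≫ (Q F).map u = (Q F).map (s ≫ a)) :
    push h.ETilde α (h.frac t ht δ s hs) = h.frac t ht (push E a δ) u hu := by
  refine (TExt.push_frac h.EBar
    ⟨(p F).obj Z, (p F).obj X, (p F).map t, FBar.map_p ht, (p F).map s, FBar.map_p hs⟩
    (h.bar δ) α ((p F).map u) (FBar.map_p hu) ((p F).map (s ≫ a)) hα
    (𝟙 _) ((FBar F).id_mem _) ((p F).map a) (by simp)).trans ?_
  have key : ∀ (u' : (p F).obj A' ⟶ (p F).obj B) (hu' : FBar F u'), u' = (p F).map u →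
      TExt.toExt (FBar F) h.EBar (TExt.mk h.EBar
        ⟨_, _, (p F).map t, FBar.map_p ht, u', hu'⟩ (h.bar (push E a δ))) =
      h.frac t ht (push E a δ) u hu := by
    rintro _ _ rfl
    rfl
  exact key _ _ (Category.comp_id _)

/-- Exactness of `𝒞̃(-, Xₙ) → 𝒞̃(-, C) → Ẽ(-, A)`. -/
lemma exact_pull_frac (h : LocAssumptions 𝔰 F) {A C X Z : 𝒞} (t : Z ⟶ C) (ht : F t)
    (δ : Ext E Z X) (s : A ⟶ X) (hs : F s) (S : NSeq n X Z) (hS : S ∈ 𝔰.cls δ) (P : CTilde F) :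
    Function.Exact (fun g : P ⟶ (Q F).obj (S.X.X n) => g ≫ (Q F).map (S.last ≫ t))
      (fun g : P ⟶ (Q F).obj C => pull h.ETilde g (h.frac t ht δ s hs)) := by
  have hδ := (h.exangulated.exangle δ S hS).cov_last
  obtain ⟨P, rfl⟩ : ∃ P₀, (Q F).obj P₀ = P :=
    let ⟨P₀, hP⟩ := (Localization.Construction.objEquiv (FBar F)).surjective P
    ⟨P₀.as, hP⟩
  intro γ
  constructor
  · intro e
    obtain ⟨B, v, hv, c, hc⟩ := h.exists_right_roof (γ ≫ (isoOfMem t ht).inv)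
    have hγ : (Q F).map v ≫ γ = (Q F).map (c ≫ t) := by
      rw [Functor.map_comp, ← hc, Category.assoc, Category.assoc]
      change _ = _ ≫ _ ≫ (isoOfMem t ht).inv ≫ (isoOfMem t ht).hom
      rw [Iso.inv_hom_id, Category.comp_id]
    have e' : pull h.ETilde γ (h.frac t ht δ s hs) = 0 := e
    rw [h.pull_frac_of_roof t ht δ s hs γ v hv c hγ, frac_eq_zero_iff, mem_K'] at e'
    obtain ⟨B', w, hw, e'⟩ := e'
    obtain ⟨g, hg⟩ := (hδ B' (w ≫ c)).1 ((pull_comp E c w δ).trans e')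
    have hg : g ≫ S.last = w ≫ c := hg
    let i := isoOfMem (w ≫ v) (M0.comp _ _ hw hv)
    refine ⟨i.inv ≫ (Q F).map g, ?_⟩
    change (i.inv ≫ (Q F).map g) ≫ (Q F).map (S.last ≫ t) = γ
    rw [Category.assoc, Iso.inv_comp_eq, ← Functor.map_comp, reassoc_of% hg,
      Functor.map_comp, ← hγ, ← Category.assoc, ← Functor.map_comp]
    rfl
  · rintro ⟨g, rfl⟩
    obtain ⟨B, v, hv, c, hc⟩ := h.exists_right_roof g
    refine (h.pull_frac_of_roof t ht δ s hs _ v hv (c ≫ S.last) ?_).trans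
      ((h.frac_eq_zero_iff v hv _ s hs).2 ?_)
    · change (Q F).map v ≫ g ≫ (Q F).map (S.last ≫ t) = _
      rw [← Category.assoc, hc, ← Functor.map_comp, Category.assoc]
    · have : pull E (c ≫ S.last) δ = 0 := (hδ B _).2 ⟨c, rfl⟩
      rw [this]
      exact zero_mem _

/-- Exactness of `𝒞̃(X₁, -) → 𝒞̃(A, -) → Ẽ(C, -)`. -/
lemma exact_push_frac (h : LocAssumptions 𝔰 F) {A C X Z : 𝒞} (t : Z ⟶ C) (ht : F t)
    (δ : Ext E Z X) (s : A ⟶ X) (hs : F s) (S : NSeq n X Z) (hS : S ∈ 𝔰.cls δ) (P : CTilde F) :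
    Function.Exact (fun g : (Q F).obj (S.X.X 1) ⟶ P => (Q F).map (s ≫ S.first) ≫ g)
      (fun g : (Q F).obj A ⟶ P => push h.ETilde g (h.frac t ht δ s hs)) := by
  have hδ := (h.exangulated.exangle δ S hS).contra_last
  obtain ⟨P, rfl⟩ : ∃ P₀, (Q F).obj P₀ = P :=
    let ⟨P₀, hP⟩ := (Localization.Construction.objEquiv (FBar F)).surjective P
    ⟨P₀.as, hP⟩
  intro α
  constructor
  · intro e
    obtain ⟨B, u, hu, a, ha⟩ := h.exists_left_roof ((isoOfMem s hs).inv ≫ α)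
    have hα : α ≫ (Q F).map u = (Q F).map (s ≫ a) := by
      rw [Functor.map_comp, ← ha]
      change _ = (isoOfMem s hs).hom ≫ _
      rw [Category.assoc, Iso.hom_inv_id_assoc]
    have e' : push h.ETilde α (h.frac t ht δ s hs) = 0 := e
    rw [h.push_frac_of_roof t ht δ s hs α u hu a hα, frac_eq_zero_iff, mem_K] at e'
    obtain ⟨B', w, hw, e'⟩ := e'
    obtain ⟨g, hg⟩ := (hδ B' (a ≫ w)).1 ((push_comp E a w δ).trans e')
    have hg : S.first ≫ g = a ≫ w := hg
    let i := isoOfMem (u ≫ w) (M0.comp _ _ hu hw)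
    refine ⟨(Q F).map g ≫ i.inv, ?_⟩
    change (Q F).map (s ≫ S.first) ≫ (Q F).map g ≫ i.inv = α
    rw [← Category.assoc, Iso.comp_inv_eq, ← Functor.map_comp, Category.assoc, hg,
      ← Category.assoc, Functor.map_comp, ← hα, Category.assoc, ← Functor.map_comp]
    rfl
  · rintro ⟨g, rfl⟩
    obtain ⟨B, u, hu, a, ha⟩ := h.exists_left_roof g
    refine (h.push_frac_of_roof t ht δ s hs _ u hu (S.first ≫ a) ?_).trans
      ((h.frac_eq_zero_iff t ht _ u hu).2 ?_)
    · change ((Q F).map (s ≫ S.first) ≫ g) ≫ (Q F).map u = _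
      rw [Category.assoc, ha, ← Functor.map_comp, Category.assoc]
    · have : push E (S.first ≫ a) δ = 0 := (hδ B _).2 ⟨a, rfl⟩
      rw [this]
      exact zero_mem _

end LocAssumptions
end NExLoc

theorem proposition3p22 {𝒞 : Type u} [Category.{v} 𝒞] [Preadditive 𝒞] [HasZeroObject 𝒞]
    [HasBinaryBiproducts 𝒞] {n : ℕ}
    (E : 𝒞ᵒᵖ ⥤ 𝒞 ⥤ AddCommGrpCat.{w}) [E.Additive] [∀ C, (E.obj C).Additive]
    (𝔰 : NExLoc.Realization n E) (F : MorphismProperty 𝒞)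
    [NExLoc.M0 F] [(NExLoc.FBar F).HasTwoOutOfThreeProperty]
    [(NExLoc.FBar F).HasLeftCalculusOfFractions] [(NExLoc.FBar F).HasRightCalculusOfFractions]
    (h : NExLoc.LocAssumptions 𝔰 F)
    (hwk : ∀ {C A : 𝒞} (δ : NExLoc.Ext E C A) (S : NExLoc.NSeq n A C), S ∈ 𝔰.cls δ →
      NExLoc.IsWeakKerCoker n
        (((NExLoc.Q F).mapHomologicalComplex (ComplexShape.up ℕ)).obj S.X))
    {A C X Z : 𝒞} (t : Z ⟶ C) (ht : F t) (δ : NExLoc.Ext E Z X) (s : A ⟶ X) (hs : F s)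
    (S : NExLoc.NSeq n X Z) (hS : S ∈ 𝔰.cls δ) :
    (NExLoc.locSeq t ht S s hs).first = (NExLoc.Q F).map (s ≫ S.first) ∧
    (NExLoc.locSeq t ht S s hs).last = (NExLoc.Q F).map (S.last ≫ t) ∧
    NExLoc.IsNExangle h.ETilde (NExLoc.locSeq t ht S s hs) (h.frac t ht δ s hs) := by
  refine ⟨NExLoc.locSeq_first t ht S s hs, NExLoc.locSeq_last t ht S s hs, hwk δ S hS, ?_, ?_⟩
  · intro P
    rw [NExLoc.locSeq_last]
    exact h.exact_pull_frac t ht δ s hs S hS P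
  · intro P
    rw [NExLoc.locSeq_first]
    exact h.exact_push_frac t ht δ s hs S hS P
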